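/- Let $X$ be a finite-dimensional real Hilbert space, $\mathcal H$ a real Hilbert space, and let $A\in\mathcal L(X)$, $B\in\mathcal L(\mathbb R^m,X)$, $C\in\mathcal L(X,\mathcal H)$, $K\in\mathcal L(\mathbb R^d,X)$, and $R\in\mathcal L(\mathbb R^m)$ symmetric positive definite. Assume that $A$ is exponentially stable, i.e. $\|e^{tA}\|\le\nu e^{-\omega t}$ for all $t\ge0$ with some $\nu\ge1$, $\omega>0$, and that $(A,C)$ is observable, i.e. $Ce^{tA}x=0$ for all $t\ge 0$ implies $x=0$. On a probability space with filtration $(\mathcal F_t)_{t\ge0}$ let $(W_t)_{t\ge0}$ be a standard $d$-dimensional Wiener process with respect to $(\mathcal F_t)$ and let $\xi\in L^2(\Omega,\mathcal F_0,X)$. (Adaptedness is understood up to null sets.) For a control $u$ let $Z=Z(u)$ be the Ornstein–Uhlenbeck process $$dZ_t=AZ_t\,dt+Bu_t\,dt+K\,dW_t,\qquad Z_0=\xi .$$ Write $\Omega_T=\Omega\times(0,T)$ and $\|f\|^2_{L^2(\Omega_T)}=\mathbb E\int_0^T\|f(t)\|^2dt$. A control is admissible if it is adapted, jointly measurable and belongs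 to $L^2(\Omega_T,\mathbb R^m)$ for every $T<\infty$; its cost is $$J(u)=\limsup_{T\to\infty}\frac1T\left(\|CZ(u)\|^2_{L^2(\Omega_T)}+\langle u,Ru\rangle_{L^2(\Omega_T)}\right)\in[0,\infty].$$ Then the following hold. 1. The Riccati equation $A^*P+PA+C^*C-PBR^{-1}B^*P=0$ has a unique symmetric positive-definite solution $P$. 2. The fixed-point equation $u_P(t)=-R^{-1}B^*PZ_t$ with $Z=Z(u_P)$ has a solution, and every solution $u_P$ is an admissible control minimizing $J$ over all admissible controls. 3. There is a sequence $(P_k)_{k\ge0}$ of positive semidefinite operators such that, with $L_0=0$, $L_k=R^{-1}B^*P_{k-1}$ for $k\ge1$ and $A_k=A-BL_k$, for every $k\ge 0$ the operator $P_k$ is the unique solution $S$ of the Lyapunov equation $A_k^*S+SA_k+C^*C+L_k^*RL_k=0$. It converges to $P$ monotonically, $P_k\ge P_{k+1}\ge P$ for all $k\ge0$, and quadratically: there is $c>0$ with $\|P_{k}-P\|\le c\|P_{k-1}-P\|^2$ and $\|P_k-P\|\le c\|P_k-P_{k-1}\|^2$ for all $k\ge1$. 4. For every $k$ the fixed-point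 equation $u_{P_k}(t)=-R^{-1}B^*P_kZ_{k,t}$ with $Z_k=Z(u_{P_k})$ has a solution. There are $\delta>0$ and $c>0$ such that for all $k\ge1$ with $\|P-P_k\|\le\delta$ and for all $T>0$ $$T^{-1/2}\|u_P-u_{P_k}\|_{L^2(\Omega_T)}\le c\,\|P_k-P_{k-1}\|^2 .$$ -/

import Mathlib

open MeasureTheory ProbabilityTheory Filter Topology
open scoped NNReal ENNReal

namespace OULQR

/-! ### Deterministic part: linear systems, Riccati and Lyapunov equations -/

section Deterministic

variable {X H U : Type*}
  [NormedAddCommGroup X] [InnerProductSpace ℝ X] [CompleteSpace X]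
  [NormedAddCommGroup H] [InnerProductSpace ℝ H] [CompleteSpace H]
  [NormedAddCommGroup U] [InnerProductSpace ℝ U] [CompleteSpace U]

/-- Symmetric and strictly positive-definite bounded operator. -/
def IsPosDefOp (S : X →L[ℝ] X) : Prop :=
  IsSelfAdjoint S ∧ ∀ x : X, x ≠ 0 → 0 < inner ℝ x (S x)

/-- The semigroup `exp (t A)` is exponentially stable. -/
def IsExpStable (A : X →L[ℝ] X) : Prop :=
  ∃ ν ω : ℝ, 1 ≤ ν ∧ 0 < ω ∧
    ∀ t : ℝ, 0 ≤ t → ‖NormedSpace.exp (t • A)‖ ≤ ν * Real.exp (-ω * t)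

/-- The pair `(A, C)` is observable: the state is determined by the uncontrolled output
`t ↦ C (exp (t A) x)`, `t ≥ 0`. -/
def IsObservable (A : X →L[ℝ] X) (C : X →L[ℝ] H) : Prop :=
  ∀ x : X, (∀ t : ℝ, 0 ≤ t → C (NormedSpace.exp (t • A) x) = 0) → x = 0

/-- The gain operator `R⁻¹ B* P`. For positive-definite `R` on a finite-dimensional space, `R` is
a unit and `Ring.inverse R` is its inverse. -/
noncomputable def gain (B : U →L[ℝ] X) (R : U →L[ℝ] U) (P : X →L[ℝ] X) : X →L[ℝ] U :=
  Ring.inverse R ∘L ContinuousLinearMap.adjoint B ∘L P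

/-- The algebraic Riccati equation `A* P + P A + C* C - P B R⁻¹ B* P = 0`. -/
def IsRiccatiSolution (A : X →L[ℝ] X) (B : U →L[ℝ] X) (C : X →L[ℝ] H) (R : U →L[ℝ] U)
    (P : X →L[ℝ] X) : Prop :=
  ContinuousLinearMap.adjoint A ∘L P + P ∘L A + ContinuousLinearMap.adjoint C ∘L C
    - P ∘L B ∘L gain B R P = 0

/-- The Lyapunov equation `(A - B L)* S + S (A - B L) + C* C + L* R L = 0` for `S`. -/
def IsLyapunovSolution (A : X →L[ℝ] X) (B : U →L[ℝ] X) (C : X →L[ℝ] H) (R : U →L[ℝ] U)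
    (L : X →L[ℝ] U) (S : X →L[ℝ] X) : Prop :=
  ContinuousLinearMap.adjoint (A - B ∘L L) ∘L S + S ∘L (A - B ∘L L)
    + ContinuousLinearMap.adjoint C ∘L C + ContinuousLinearMap.adjoint L ∘L R ∘L L = 0

/-- The gains of the iteration: `L₀ = 0` and `L_{k+1} = R⁻¹ B* P_k`. -/
noncomputable def iterGain (B : U →L[ℝ] X) (R : U →L[ℝ] U) (Pk : ℕ → X →L[ℝ] X) :
    ℕ → X →L[ℝ] U
  | 0 => 0
  | k + 1 => gain B R (Pk k)

end Deterministic

/-! ### Stochastic part -/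

section Stochastic

variable {Ω : Type*} [mΩ : MeasurableSpace Ω]

/-- Standard `d`-dimensional Wiener process with respect to the filtration `F`: it is adapted, its
coordinates are mutually independent real Brownian motions, and its increments after time `s` are
independent of `F s`. -/
structure IsWiener {d : ℕ} (μ : Measure Ω) (F : Filtration ℝ≥0 mΩ)
    (W : ℝ≥0 → Ω → EuclideanSpace ℝ (Fin d)) : Prop where
  adapted : StronglyAdapted F W
  brownian : ∀ i : Fin d, IsBrownianReal (fun t ω => W t ω i) μ
  indep_coord : iIndepFun (fun (i : Fin d) (ω : Ω) (t : ℝ≥0) => W t ω i) μ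
  indep_increment : ∀ s t : ℝ≥0, s ≤ t →
    Indep (F s) (MeasurableSpace.comap (fun ω => W t ω - W s ω) inferInstance) μ

/-- The process is adapted to the filtration `F` augmented by the `μ`-null sets. -/
def IsAEAdapted {E : Type*} [TopologicalSpace E] (μ : Measure Ω) (F : Filtration ℝ≥0 mΩ)
    (u : ℝ≥0 → Ω → E) : Prop :=
  ∀ t : ℝ≥0, AEStronglyMeasurable[F t] (u t) μ

/-- The square of the norm of `L²(Ω × (0,T), E)`, i.e. `𝔼 ∫_(0,T) ‖f(t)‖² dt`. -/
noncomputable def sqNormOmegaT {E : Type*} [NormedAddCommGroup E] (μ : Measure Ω) (T : ℝ)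
    (f : ℝ≥0 → Ω → E) : ℝ≥0∞ :=
  ∫⁻ ω, ∫⁻ t in Set.Ioo (0 : ℝ) T, ‖f t.toNNReal ω‖ₑ ^ 2 ∂volume ∂μ

/-- The norm of `L²(Ω × (0,T), E)`. -/
noncomputable def normOmegaT {E : Type*} [NormedAddCommGroup E] (μ : Measure Ω) (T : ℝ)
    (f : ℝ≥0 → Ω → E) : ℝ≥0∞ :=
  (sqNormOmegaT μ T f) ^ (1 / 2 : ℝ)

/-- Admissible controls on the infinite horizon: jointly measurable adapted processes
lying in `L²(Ω × (0,T))` for every finite `T`. -/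
structure IsAdmissible {U : Type*} [NormedAddCommGroup U] (μ : Measure Ω)
    (F : Filtration ℝ≥0 mΩ) (u : ℝ≥0 → Ω → U) : Prop where
  measurable : AEStronglyMeasurable (fun p : ℝ × Ω => u p.1.toNNReal p.2)
    ((volume.restrict (Set.Ioi (0 : ℝ))).prod μ)
  adapted : IsAEAdapted μ F u
  square_integrable : ∀ T : ℝ, 0 < T → sqNormOmegaT μ T u < ∞

variable {X H U : Type*}
  [NormedAddCommGroup X] [InnerProductSpace ℝ X] [CompleteSpace X]
  [NormedAddCommGroup H] [InnerProductSpace ℝ H] [CompleteSpace H]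
  [NormedAddCommGroup U] [InnerProductSpace ℝ U] [CompleteSpace U]

/-- `Z` is the controlled Ornstein-Uhlenbeck process `dZ = A Z dt + B u dt + K dW`, `Z_0 = ξ`:
a continuous adapted process satisfying the integrated equation. The noise being additive, the
stochastic integral of the constant operator `K` is `K W_t`. -/
structure IsOUProcess {d : ℕ} (μ : Measure Ω) (F : Filtration ℝ≥0 mΩ)
    (A : X →L[ℝ] X) (B : U →L[ℝ] X) (K : EuclideanSpace ℝ (Fin d) →L[ℝ] X)
    (W : ℝ≥0 → Ω → EuclideanSpace ℝ (Fin d)) (ξ : Ω → X)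
    (u : ℝ≥0 → Ω → U) (Z : ℝ≥0 → Ω → X) : Prop where
  adapted : IsAEAdapted μ F Z
  continuous : ∀ᵐ ω ∂μ, Continuous fun t => Z t ω
  equation : ∀ᵐ ω ∂μ, ∀ t : ℝ≥0,
    Z t ω = ξ ω + (∫ s in (0 : ℝ)..t, (A (Z s.toNNReal ω) + B (u s.toNNReal ω))) + K (W t ω)

/-- The feedback control `u(t) = -R⁻¹ B* P Z_t`. -/
noncomputable def feedback (B : U →L[ℝ] X) (R : U →L[ℝ] U) (P : X →L[ℝ] X)
    (Z : ℝ≥0 → Ω → X) : ℝ≥0 → Ω → U :=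
  fun t ω => -(gain B R P (Z t ω))

/-- The finite-horizon cost `T⁻¹ (‖C Z‖² + ⟨u, R u⟩)`, the norm and the product being those
of `L²(Ω × (0,T))`. It takes values in `[0, ∞]`; `R` is used only when it is positive. -/
noncomputable def cost (μ : Measure Ω) (C : X →L[ℝ] H) (R : U →L[ℝ] U)
    (Z : ℝ≥0 → Ω → X) (u : ℝ≥0 → Ω → U) (T : ℝ) : ℝ≥0∞ :=
  (ENNReal.ofReal T)⁻¹ *
    (sqNormOmegaT μ T (fun t ω => C (Z t ω)) +
      ∫⁻ ω, ∫⁻ t in Set.Ioo (0 : ℝ) T,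
        ENNReal.ofReal (inner ℝ (u t.toNNReal ω) (R (u t.toNNReal ω))) ∂volume ∂μ)

/-- The infinite-horizon cost `limsup_{T → ∞}` of the finite-horizon costs. -/
noncomputable def costInfty (μ : Measure Ω) (C : X →L[ℝ] H) (R : U →L[ℝ] U)
    (Z : ℝ≥0 → Ω → X) (u : ℝ≥0 → Ω → U) : ℝ≥0∞ :=
  limsup (fun T : ℝ => cost μ C R Z u T) atTop

/-- The feedback law with operator `P` solves the infinite-horizon optimal control problem: the
fixed-point equation for the process controlled by its own feedback is solvable, and every such
solution yields an admissible control whose cost is minimal among all admissible controls. -/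
def FeedbackIsOptimal {d : ℕ} (μ : Measure Ω) (F : Filtration ℝ≥0 mΩ)
    (A : X →L[ℝ] X) (B : U →L[ℝ] X) (C : X →L[ℝ] H) (R : U →L[ℝ] U)
    (K : EuclideanSpace ℝ (Fin d) →L[ℝ] X)
    (W : ℝ≥0 → Ω → EuclideanSpace ℝ (Fin d)) (ξ : Ω → X) (P : X →L[ℝ] X) : Prop :=
  (∃ Z : ℝ≥0 → Ω → X, IsOUProcess μ F A B K W ξ (feedback B R P Z) Z) ∧
  ∀ Z : ℝ≥0 → Ω → X, IsOUProcess μ F A B K W ξ (feedback B R P Z) Z →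
    IsAdmissible μ F (feedback B R P Z) ∧
    ∀ (v : ℝ≥0 → Ω → U) (Y : ℝ≥0 → Ω → X), IsAdmissible μ F v →
      IsOUProcess μ F A B K W ξ v Y →
      costInfty μ C R Z (feedback B R P Z) ≤ costInfty μ C R Y v

end Stochastic

end OULQR

/-!
Write `S = B R⁻¹ B*` and `Q = C* C`, and let the closed loop of a feedback operator `P` be
`A - S P`.

*Riccati equation.* The sequence is Kleinman's policy iteration, that is, Newton's method for the
Riccati equation, started from the zero operator. Everything rests on Lyapunov equations
`F* D + D F = -N` with stable `F`: they are uniquely solvable since the Sylvester equation has only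
the trivial solution (`eq_zero_of_sylvester`), and positive `N` gives positive `D`
(`isPositive_of_lyapunov`). Each iterate keeps the closed loop stable (`isExpStable_sub`: this
uses only that `A` is stable, no observability), the iterates decrease, hence converge, and the
error satisfies a Lyapunov equation with quadratic right-hand side (`kleinman_error`), which gives
both quadratic estimates (`kleinman_convergence`). Uniqueness among positive solutions is
`RiccatiEq.unique`; observability makes the solution strictly positive
(`RiccatiEq.isPosDefOp`).

*Processes.* The noise is additive, so that paths are handled by variation of constants, and no
stochastic integral is needed. The one probabilistic fact is `energy_identity`, the expectation of
Itô's formula for a quadratic form: subtracting `K W` leaves absolutely continuous paths with the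
usual product rule, and the remaining cross terms vanish since increments of `W` are orthogonal to
the past.

*Optimality.* Completing the square with the Riccati equation turns the energy identity for `P` into
`cost + 𝔼⟨P Z_T, Z_T⟩ = 𝔼⟨P ξ, ξ⟩ + T tr(K* P K) + 𝔼 ∫ ⟨v, R v⟩` with `v` the deviation of the
control from the feedback law (`costIntegral_add_eq`). For the feedback itself `v = 0`, so its
cost is at most the trace. If another control cost less, then `𝔼⟨P Z_T, Z_T⟩` would grow at least
linearly at all late times, so its time integral would grow quadratically. But a control of finite
cost, together with the stability of `A`, bounds that time integral linearly (`le_costInfty`).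

*Error of the feedback controls.* The difference of two processes driven by the same noise is itself
a noiseless controlled process, the control being one of the two processes, acting through the
difference of the drifts. The second moment bound therefore applies to it
(`exists_normOmegaT_feedback_sub_le`), and the quadratic convergence of the iteration concludes.
-/

namespace OULQR

/-! ### Exponential stability and Lyapunov equations -/

section LyapunovTheory

variable {X : Type*} [NormedAddCommGroup X] [InnerProductSpace ℝ X]

lemma IsExpStable.tendsto_exp {F : X →L[ℝ] X} (hF : IsExpStable F) :
    Tendsto (fun t : ℝ => NormedSpace.exp (t • F)) atTop (𝓝 0) := by
  obtain ⟨ν, ω, -, hω, h⟩ := hF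
  rw [tendsto_zero_iff_norm_tendsto_zero]
  have h1 : Tendsto (fun t : ℝ => ν * Real.exp (-ω * t)) atTop (𝓝 (ν * 0)) := by
    refine Tendsto.const_mul _ (Real.tendsto_exp_atBot.comp ?_)
    exact tendsto_id.const_mul_atTop_of_neg (by linarith)
  rw [mul_zero] at h1
  refine tendsto_of_tendsto_of_tendsto_of_le_of_le' tendsto_const_nhds h1
    (Eventually.of_forall fun t => norm_nonneg _) ?_
  filter_upwards [eventually_ge_atTop 0] with t ht using h t ht

variable [CompleteSpace X]

lemma inner_star_apply (F : X →L[ℝ] X) (x y : X) : inner ℝ (star F x) y = inner ℝ x (F y) := by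
  rw [ContinuousLinearMap.star_eq_adjoint, ContinuousLinearMap.adjoint_inner_left]

lemma inner_apply_star (F : X →L[ℝ] X) (x y : X) : inner ℝ x (star F y) = inner ℝ (F x) y := by
  rw [ContinuousLinearMap.star_eq_adjoint, ContinuousLinearMap.adjoint_inner_right]

lemma _root_.IsSelfAdjoint.inner_apply_comm {S : X →L[ℝ] X} (hS : IsSelfAdjoint S) (x y : X) :
    inner ℝ (S x) y = inner ℝ x (S y) := by
  conv_lhs => rw [← hS.star_eq]
  exact inner_star_apply S x y

lemma hasDerivAt_exp_smul_apply (F : X →L[ℝ] X) (x : X) (t : ℝ) :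
    HasDerivAt (fun t : ℝ => NormedSpace.exp (t • F) x) (F (NormedSpace.exp (t • F) x)) t := by
  simpa using (hasDerivAt_exp_smul_const' (𝕂 := ℝ) F t).clm_apply (hasDerivAt_const t x)

/-- The Sylvester equation `F* D + D G = 0` with exponentially stable `F` and `G` has only the
trivial solution: `t ↦ exp (t F)* D exp (t G)` is constant and tends to `0`. -/
theorem eq_zero_of_sylvester {F G D : X →L[ℝ] X} (hF : IsExpStable F) (hG : IsExpStable G)
    (h : star F * D + D * G = 0) : D = 0 := by
  set φ : ℝ → X →L[ℝ] X := fun t => star (NormedSpace.exp (t • F)) * D * NormedSpace.exp (t • G)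
    with hφ
  have hd : ∀ t, HasDerivAt φ 0 t := by
    intro t
    have h1 := ((hasDerivAt_exp_smul_const' (𝕂 := ℝ) F t).star.mul_const D).mul
      (hasDerivAt_exp_smul_const' (𝕂 := ℝ) G t)
    refine h1.congr_deriv ?_
    rw [star_mul]
    symm
    calc (0 : X →L[ℝ] X) = star (NormedSpace.exp (t • F)) * (star F * D + D * G)
          * NormedSpace.exp (t • G) := by rw [h]; simp
      _ = _ := by noncomm_ring
  have hconst : ∀ t, φ t = D := fun t => by
    have := is_const_of_deriv_eq_zero (fun s => (hd s).differentiableAt) (fun s => (hd s).deriv) t 0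
    simpa [hφ] using this
  have hlim : Tendsto φ atTop (𝓝 (star 0 * D * 0)) :=
    ((hF.tendsto_exp.star).mul tendsto_const_nhds).mul hG.tendsto_exp
  rw [mul_zero] at hlim
  exact tendsto_nhds_unique (tendsto_const_nhds.congr fun t => (hconst t).symm) hlim

lemma inner_lyapunov (F D : X →L[ℝ] X) (hD : IsSelfAdjoint D) (x : X) :
    inner ℝ x ((star F * D + D * F) x) = 2 * inner ℝ (D x) (F x) := by
  simp only [add_apply, mul_apply_eq_comp, inner_add_right,
    inner_apply_star]
  rw [← hD.inner_apply_comm x (F x), real_inner_comm (D x) (F x)]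
  ring

/-- Along the flow of `F` the quadratic form of `D` decreases, and it tends to `0` by stability; so
it is nonnegative at the start. -/
theorem isPositive_of_lyapunov {F D N : X →L[ℝ] X} (hF : IsExpStable F) (hD : IsSelfAdjoint D)
    (hN : N.IsPositive) (h : star F * D + D * F = -N) : D.IsPositive := by
  rw [ContinuousLinearMap.isPositive_iff']
  refine ⟨hD, fun x => ?_⟩
  set e : ℝ → X := fun t => NormedSpace.exp (t • F) x with he
  set f : ℝ → ℝ := fun t => inner ℝ (D (e t)) (e t) with hf
  have hd : ∀ t, HasDerivAt f (-inner ℝ (e t) (N (e t))) t := by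
    intro t
    have h1 := hasDerivAt_exp_smul_apply F x t
    have h2 := (D.hasFDerivAt.comp_hasDerivAt t h1).inner ℝ h1
    refine h2.congr_deriv ?_
    have h3 := inner_lyapunov F D hD (e t)
    rw [h] at h3
    simp only [neg_apply, inner_neg_right] at h3
    rw [h3]
    simp only [Function.comp_apply, he]
    rw [hD.inner_apply_comm (F _), real_inner_comm (D _) (F _)]
    ring
  have hanti : Antitone f := antitone_of_deriv_nonpos (fun t => (hd t).differentiableAt)
    fun t => by rw [(hd t).deriv]; linarith [hN.inner_nonneg_right (e t)]
  have hlim0 : Tendsto e atTop (𝓝 0) := by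
    have h1 := ((ContinuousLinearMap.apply ℝ X x).continuous.tendsto 0).comp hF.tendsto_exp
    simpa using! h1
  have hlim : Tendsto f atTop (𝓝 0) := by
    have h1 := ((D.continuous.tendsto 0).comp hlim0).inner (𝕜 := ℝ) hlim0
    simpa using! h1
  have : 0 ≤ f 0 := hanti.le_of_tendsto hlim 0
  simpa [hf, he] using this

/-- Lyapunov's criterion for exponential stability: a coercive quadratic form `M` that is strictly
dissipated along the flow decays exponentially. -/
theorem IsExpStable.of_lyapunov {F M : X →L[ℝ] X} (hM : IsSelfAdjoint M) {m c : ℝ} (hm : 0 < m)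
    (hc : 0 < c) (h1 : ∀ x, m * ‖x‖ ^ 2 ≤ inner ℝ (M x) x)
    (h2 : ∀ x, 2 * inner ℝ (M x) (F x) ≤ -c * ‖x‖ ^ 2) : IsExpStable F := by
  -- the rate at which the form of `M` decays: `c ‖x‖² ≥ κ ⟨M x, x⟩`
  set κ : ℝ := c / (‖M‖ + 1) with hκ
  have hκ0 : 0 < κ := by positivity
  have hκM : κ * ‖M‖ ≤ c := by
    rw [hκ, div_mul_eq_mul_div, div_le_iff₀ (by positivity)]
    nlinarith [norm_nonneg M]
  have hMle : ∀ x, inner ℝ (M x) x ≤ ‖M‖ * ‖x‖ ^ 2 := fun x => by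
    calc inner ℝ (M x) x ≤ ‖M x‖ * ‖x‖ := real_inner_le_norm _ _
      _ ≤ ‖M‖ * ‖x‖ * ‖x‖ := by gcongr; exact M.le_opNorm x
      _ = _ := by ring
  have key : ∀ x : X, ∀ t : ℝ, 0 ≤ t →
      m * ‖NormedSpace.exp (t • F) x‖ ^ 2 ≤ Real.exp (-κ * t) * (‖M‖ * ‖x‖ ^ 2) := by
    intro x t ht
    set e : ℝ → X := fun t => NormedSpace.exp (t • F) x with he
    set f : ℝ → ℝ := fun t => Real.exp (κ * t) * inner ℝ (M (e t)) (e t) with hf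
    have hd : ∀ t, HasDerivAt f (Real.exp (κ * t) *
        (κ * inner ℝ (M (e t)) (e t) + 2 * inner ℝ (M (e t)) (F (e t)))) t := by
      intro t
      have h1 := hasDerivAt_exp_smul_apply F x t
      have h2 := (M.hasFDerivAt.comp_hasDerivAt t h1).inner ℝ h1
      have h3 := (((hasDerivAt_id t).const_mul κ).exp).mul h2
      refine h3.congr_deriv ?_
      simp only [Function.comp_apply, id, he]
      rw [hM.inner_apply_comm (F _), real_inner_comm (M _) (F _)]
      ring
    have hanti : Antitone f := antitone_of_deriv_nonpos (fun t => (hd t).differentiableAt)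
      fun t => by
        rw [(hd t).deriv]
        refine mul_nonpos_of_nonneg_of_nonpos (Real.exp_pos _).le ?_
        have := mul_le_mul_of_nonneg_left (hMle (e t)) hκ0.le
        nlinarith [h2 (e t), sq_nonneg ‖e t‖]
    have h3 : f t ≤ f 0 := hanti ht
    have h4 : f 0 = inner ℝ (M x) x := by simp [hf, he]
    rw [h4] at h3
    have h5 := h3.trans (hMle x)
    have h6 : Real.exp (-κ * t) * Real.exp (κ * t) = 1 := by
      rw [← Real.exp_add]; simp
    calc m * ‖e t‖ ^ 2 ≤ inner ℝ (M (e t)) (e t) := h1 _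
      _ = Real.exp (-κ * t) * f t := by simp only [hf]; rw [← mul_assoc, h6, one_mul]
      _ ≤ _ := by gcongr
  refine ⟨max 1 (Real.sqrt (‖M‖ / m)), κ / 2, le_max_left _ _, by positivity, fun t ht => ?_⟩
  refine ContinuousLinearMap.opNorm_le_bound _ (by positivity) fun x => ?_
  have h7 : ‖NormedSpace.exp (t • F) x‖ ^ 2 ≤
      (Real.sqrt (‖M‖ / m) * Real.exp (-(κ / 2) * t) * ‖x‖) ^ 2 := by
    rw [mul_pow, mul_pow, Real.sq_sqrt (by positivity), ← Real.exp_nat_mul]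
    have := key x t ht
    rw [mul_comm, ← le_div_iff₀ hm] at this
    refine this.trans (le_of_eq ?_)
    have h8 : ((2 : ℕ) : ℝ) * (-(κ / 2) * t) = -κ * t := by push_cast; ring
    rw [h8]; field_simp
  have h9 := (sq_le_sq₀ (norm_nonneg _) (by positivity)).1 h7
  refine h9.trans ?_
  gcongr
  exact le_max_right _ _

/-- Cauchy-Schwarz for a positive semidefinite form, in its arithmetic mean version. -/
lemma abs_inner_le_of_isPositive {M : X →L[ℝ] X} (hM : M.IsPositive) (x y : X) :
    |inner ℝ (M x) y| ≤ (inner ℝ (M x) x + inner ℝ (M y) y) / 2 := by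
  have h1 := hM.inner_nonneg_left (x + y)
  have h2 := hM.inner_nonneg_left (x - y)
  have h3 : inner ℝ (M y) x = inner ℝ (M x) y := by
    rw [hM.isSelfAdjoint.inner_apply_comm, real_inner_comm]
  simp only [map_add, map_sub, inner_add_left, inner_add_right, inner_sub_left,
    inner_sub_right, h3] at h1 h2
  rw [abs_le]; constructor <;> linarith

/-- A null vector of a positive quadratic form lies in the kernel. -/
lemma _root_.ContinuousLinearMap.IsPositive.apply_eq_zero {M : X →L[ℝ] X} (hM : M.IsPositive)
    {x : X} (h : inner ℝ (M x) x = 0) : M x = 0 := by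
  have hz : ∀ s : ℝ, 0 ≤ 2 * s * inner ℝ (M x) (M x) + s ^ 2 * inner ℝ (M (M x)) (M x) := by
    intro s
    have := hM.inner_nonneg_right (x + s • M x)
    simp only [map_add, map_smul, inner_add_left, inner_add_right, real_inner_smul_left,
      real_inner_smul_right] at this
    rw [← hM.isSelfAdjoint.inner_apply_comm x x, h, ← hM.isSelfAdjoint.inner_apply_comm x (M x),
      ← hM.isSelfAdjoint.inner_apply_comm (M x) (M x)] at this
    linarith
  by_contra hne
  have hp : 0 < inner ℝ (M x) (M x) := real_inner_self_pos.2 hne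
  set a := inner ℝ (M x) (M x)
  set b := inner ℝ (M (M x)) (M x)
  have hb : 0 ≤ b := hM.inner_nonneg_left _
  -- at this `s` the linear term outweighs the quadratic one
  have := hz (-a / (b + 1))
  have e : 2 * (-a / (b + 1)) * a + (-a / (b + 1)) ^ 2 * b
      = -(a ^ 2 * (b + 2) / (b + 1) ^ 2) := by field_simp; ring
  rw [e] at this
  have : 0 < a ^ 2 * (b + 2) / (b + 1) ^ 2 := by positivity
  linarith

/-- The Lyapunov map `S ↦ F* S + S F`. -/
noncomputable def lyapunovMap (F : X →L[ℝ] X) : (X →L[ℝ] X) →ₗ[ℝ] (X →L[ℝ] X) :=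
  LinearMap.mulLeft ℝ (star F) + LinearMap.mulRight ℝ F

@[simp] lemma lyapunovMap_apply (F S : X →L[ℝ] X) : lyapunovMap F S = star F * S + S * F := rfl

lemma lyapunovMap_injective {F : X →L[ℝ] X} (hF : IsExpStable F) :
    Function.Injective (lyapunovMap F) := by
  rw [← LinearMap.ker_eq_bot, LinearMap.ker_eq_bot']
  exact fun D h => eq_zero_of_sylvester hF hF h

variable [FiniteDimensional ℝ X]

/-- Solutions of Lyapunov equations are bounded by their right-hand sides. In finite dimension this
follows from uniqueness. -/
lemma exists_norm_le_lyapunovMap {F : X →L[ℝ] X} (hF : IsExpStable F) :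
    ∃ c : ℝ, 0 ≤ c ∧ ∀ S, ‖S‖ ≤ c * ‖star F * S + S * F‖ := by
  obtain ⟨K, -, hK⟩ := (lyapunovMap F).exists_antilipschitzWith
    (LinearMap.ker_eq_bot.2 (lyapunovMap_injective hF))
  refine ⟨K, K.2, fun S => ?_⟩
  have h := hK.le_mul_norm_sub S 0
  simp only [map_zero, add_zero, norm_neg] at h
  exact h

/-- For exponentially stable `F` and self-adjoint `N`, the Lyapunov equation `F* S + S F = -N` has
a unique solution, which is self-adjoint. -/
theorem exists_lyapunov {F N : X →L[ℝ] X} (hF : IsExpStable F) (hN : IsSelfAdjoint N) :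
    ∃ S : X →L[ℝ] X, IsSelfAdjoint S ∧ ∀ T, star F * T + T * F = -N ↔ T = S := by
  obtain ⟨S, hS⟩ := LinearMap.injective_iff_surjective.1 (lyapunovMap_injective hF) (-N)
  have huniq : ∀ T, star F * T + T * F = -N ↔ T = S := fun T =>
    ⟨fun h => lyapunovMap_injective hF (h.trans hS.symm), fun h => h ▸ hS⟩
  refine ⟨S, ?_, huniq⟩
  refine (huniq (star S)).1 ?_
  have := congrArg star hS
  simpa [hN.star_eq, add_comm] using this

/-- A positive definite form is coercive in finite dimension. -/
lemma IsPosDefOp.exists_coercive {S : X →L[ℝ] X} (hS : IsPosDefOp S) :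
    ∃ m : ℝ, 0 < m ∧ ∀ x, m * ‖x‖ ^ 2 ≤ inner ℝ (S x) x := by
  rcases subsingleton_or_nontrivial X with hX | hX
  · exact ⟨1, one_pos, fun x => by simp [Subsingleton.elim x 0]⟩
  obtain ⟨x₀, hx₀, hmin⟩ := (isCompact_sphere (0 : X) 1).exists_isMinOn
    (NormedSpace.sphere_nonempty.2 zero_le_one)
    (f := fun x => inner ℝ (S x) x) (by fun_prop)
  have hx₀' : ‖x₀‖ = 1 := by simpa using hx₀
  refine ⟨inner ℝ (S x₀) x₀, ?_, fun x => ?_⟩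
  · rw [real_inner_comm]
    exact hS.2 x₀ (by rw [← norm_pos_iff, hx₀']; exact one_pos)
  · rcases eq_or_ne x 0 with rfl | hx
    · simp
    have hx' : 0 < ‖x‖ := norm_pos_iff.2 hx
    have h1 : ‖x‖⁻¹ • x ∈ Metric.sphere (0 : X) 1 := by
      simp [norm_smul, hx'.ne']
    have h2 : inner ℝ (S x₀) x₀ ≤ inner ℝ (S (‖x‖⁻¹ • x)) (‖x‖⁻¹ • x) := hmin h1
    rw [map_smul, real_inner_smul_left, real_inner_smul_right] at h2
    calc _ ≤ (‖x‖⁻¹ * (‖x‖⁻¹ * inner ℝ (S x) x)) * ‖x‖ ^ 2 := by gcongr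
      _ = _ := by field_simp

/-- A quadratic Lyapunov function for an exponentially stable operator. -/
theorem IsExpStable.exists_lyapunov_function {F : X →L[ℝ] X} (hF : IsExpStable F) :
    ∃ M : X →L[ℝ] X, IsPosDefOp M ∧ star F * M + M * F = -1 := by
  obtain ⟨M, hM, h⟩ := exists_lyapunov hF (IsSelfAdjoint.one (X →L[ℝ] X))
  have hM1 := (h M).2 rfl
  have hpos := isPositive_of_lyapunov hF hM ContinuousLinearMap.isPositive_one hM1
  refine ⟨M, ⟨hM, fun x hx => ?_⟩, hM1⟩
  refine lt_of_le_of_ne (hpos.inner_nonneg_right x) fun h0 => hx ?_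
  have h2 := inner_lyapunov F M hM x
  rw [hM1] at h2
  have h3 : M x = 0 :=
    hpos.apply_eq_zero (by rw [real_inner_comm]; exact h0.symm)
  simp only [h3, inner_zero_left, mul_zero, neg_apply,
    one_apply_eq_self, inner_neg_right, neg_eq_zero] at h2
  exact inner_self_eq_zero.1 h2

end LyapunovTheory

/-! ### Positive operators -/

section PositiveOperators

variable {X : Type*} [NormedAddCommGroup X] [InnerProductSpace ℝ X] [CompleteSpace X]

/-- The operator norm is monotone on positive operators. -/
lemma norm_le_norm_of_isPositive {S T : X →L[ℝ] X} (hS : S.IsPositive)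
    (hST : (T - S).IsPositive) : ‖S‖ ≤ ‖T‖ := by
  have hq : ∀ x : X, ‖x‖ = 1 → inner ℝ (S x) x ≤ ‖T‖ := by
    intro x hx
    have h1 := hST.inner_nonneg_left x
    rw [sub_apply, inner_sub_left] at h1
    have h2 : inner ℝ (T x) x ≤ ‖T x‖ * ‖x‖ := real_inner_le_norm _ _
    have h3 := T.le_opNorm x
    rw [hx, mul_one] at h2 h3
    linarith
  refine ContinuousLinearMap.opNorm_le_of_unit_norm (norm_nonneg _) fun x hx => ?_
  rcases eq_or_ne (S x) 0 with h0 | h0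
  · rw [h0, norm_zero]; exact norm_nonneg _
  have hn : ‖S x‖ ≠ 0 := norm_ne_zero_iff.2 h0
  have h1 := (le_abs_self _).trans (abs_inner_le_of_isPositive hS x (‖S x‖⁻¹ • S x))
  rw [real_inner_smul_right, real_inner_self_eq_norm_sq] at h1
  have h2 := hq x hx
  have h3 := hq (‖S x‖⁻¹ • S x) (by rw [norm_smul, norm_inv, norm_norm, inv_mul_cancel₀ hn])
  have h4 : ‖S x‖⁻¹ * ‖S x‖ ^ 2 = ‖S x‖ := by field_simp
  linarith

lemma isPositive_of_tendsto {T : ℕ → X →L[ℝ] X} {P : X →L[ℝ] X} (h : Tendsto T atTop (𝓝 P))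
    (hT : ∀ᶠ n in atTop, (T n).IsPositive) : P.IsPositive := by
  rw [ContinuousLinearMap.isPositive_iff']
  have hev : ∀ x, Tendsto (fun n => T n x) atTop (𝓝 (P x)) := fun x =>
    ((ContinuousLinearMap.apply ℝ X x).continuous.tendsto P).comp h
  constructor
  · have h1 : Tendsto (fun n => star (T n)) atTop (𝓝 (star P)) := h.star
    refine tendsto_nhds_unique (h1.congr' ?_) h
    filter_upwards [hT] with n hn using hn.isSelfAdjoint.star_eq
  · intro x
    refine ge_of_tendsto ((hev x).inner (tendsto_const_nhds (x := x))) ?_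
    filter_upwards [hT] with n hn using hn.inner_nonneg_left x

/-- A decreasing sequence of positive operators on a finite-dimensional space converges in norm. -/
theorem exists_tendsto_of_decreasing [FiniteDimensional ℝ X] {T : ℕ → X →L[ℝ] X}
    (hT : ∀ n, (T n).IsPositive) (hdec : ∀ n, (T n - T (n + 1)).IsPositive) :
    ∃ P, Tendsto T atTop (𝓝 P) ∧ ∀ n, (T n - P).IsPositive := by
  have hanti : Antitone T := antitone_nat_of_succ_le hdec
  have : ProperSpace (X →L[ℝ] X) := FiniteDimensional.proper ℝ _
  obtain ⟨P, -, φ, hφ, hlim⟩ := (isCompact_closedBall (0 : X →L[ℝ] X) ‖T 0‖).tendsto_subseq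
    (x := T) fun n => by
      rw [mem_closedBall_zero_iff]
      exact norm_le_norm_of_isPositive (hT n) (hanti (Nat.zero_le n))
  have hpos : ∀ n, (T n - P).IsPositive := fun n =>
    isPositive_of_tendsto (T := fun m => T n - T (φ m)) (tendsto_const_nhds.sub hlim) <| by
      filter_upwards [eventually_ge_atTop n] with m hm
      exact hanti (hm.trans (hφ.id_le m))
  refine ⟨P, ?_, hpos⟩
  rw [tendsto_iff_norm_sub_tendsto_zero]
  have hn : Antitone fun n => ‖T n - P‖ := antitone_nat_of_succ_le fun n =>
    norm_le_norm_of_isPositive (hpos (n + 1)) (by simpa using hdec n)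
  exact (tendsto_iff_tendsto_subseq_of_antitone hn hφ.tendsto_atTop).2
    (tendsto_iff_norm_sub_tendsto_zero.1 hlim)

lemma IsSelfAdjoint.star_sub_mul {S P : X →L[ℝ] X} (hS : IsSelfAdjoint S) (hP : IsSelfAdjoint P)
    (A : X →L[ℝ] X) : star (A - S * P) = star A - P * S := by
  rw [star_sub, star_mul, hS.star_eq, hP.star_eq]

lemma isPositive_mul_mul {S D : X →L[ℝ] X} (hS : S.IsPositive) (hD : IsSelfAdjoint D) :
    (D * S * D).IsPositive := by
  have h := hS.conj_adjoint D
  rwa [← ContinuousLinearMap.star_eq_adjoint, hD.star_eq] at h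

end PositiveOperators

/-! ### The Riccati equation and the Kleinman iteration -/

section Kleinman

variable {X : Type*} [NormedAddCommGroup X] [InnerProductSpace ℝ X] [CompleteSpace X]
  {A S Q : X →L[ℝ] X}

/-- If `A` is exponentially stable and the quadratic form of `P ≥ 0` dissipates `P S P` along
`A - S P`, then `A - S P` is exponentially stable. A strict Lyapunov function is `P + ε M`, where
`M` is one for `A`; the cross term `ε M S P` is absorbed by the dissipation and by `ε`. -/
theorem isExpStable_sub [FiniteDimensional ℝ X] (hA : IsExpStable A) (hS : S.IsPositive)
    {N P : X →L[ℝ] X} (hN : N.IsPositive) (hP : P.IsPositive)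
    (h : star (A - S * P) * P + P * (A - S * P) = -(N + P * S * P)) : IsExpStable (A - S * P) := by
  obtain ⟨M, hM, hMA⟩ := hA.exists_lyapunov_function
  obtain ⟨m, hm, hmM⟩ := hM.exists_coercive
  set ε : ℝ := 1 / (2 * (‖S‖ * ‖M‖ ^ 2 + 1)) with hε
  have hε0 : 0 < ε := by positivity
  have hεS : ε * (‖S‖ * ‖M‖ ^ 2) ≤ 1 / 2 := by
    rw [hε, div_mul_eq_mul_div, div_le_div_iff₀ (by positivity) (by positivity)]
    nlinarith [norm_nonneg S, sq_nonneg ‖M‖]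
  refine IsExpStable.of_lyapunov (M := P + ε • M) (m := ε * m) (c := ε / 2) ?_ (by positivity)
    (by positivity) (fun x => ?_) (fun x => ?_)
  · exact hP.isSelfAdjoint.add ((IsSelfAdjoint.all ε).smul hM.1)
  · rw [add_apply, inner_add_left, smul_apply, real_inner_smul_left]
    have := mul_le_mul_of_nonneg_left (hmM x) hε0.le
    nlinarith [hP.inner_nonneg_left x]
  · have h1 := inner_lyapunov (A - S * P) P hP.isSelfAdjoint x
    have h2 := inner_lyapunov A M hM.1 x
    rw [h] at h1
    rw [hMA] at h2
    -- controls the cross term `ε ⟨M x, S P x⟩` from below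
    have h3 := hS.inner_nonneg_left (ε • M x + P x)
    have h4 := hN.inner_nonneg_right x
    have h5 : inner ℝ (S (M x)) (M x) ≤ ‖S‖ * ‖M‖ ^ 2 * ‖x‖ ^ 2 := by
      calc inner ℝ (S (M x)) (M x) ≤ ‖S (M x)‖ * ‖M x‖ := real_inner_le_norm _ _
        _ ≤ (‖S‖ * (‖M‖ * ‖x‖)) * (‖M‖ * ‖x‖) := by
          gcongr
          · exact (S.le_opNorm _).trans (by gcongr; exact M.le_opNorm x)
          · exact M.le_opNorm x
        _ = _ := by ring
    have h6 : inner ℝ x (P (S (P x))) = inner ℝ (S (P x)) (P x) := by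
      rw [← hP.isSelfAdjoint.inner_apply_comm, real_inner_comm]
    have h7 : inner ℝ (S (P x)) (M x) = inner ℝ (M x) (S (P x)) := real_inner_comm _ _
    have h8 : inner ℝ (S (M x)) (P x) = inner ℝ (M x) (S (P x)) :=
      hS.isSelfAdjoint.inner_apply_comm _ _
    simp only [neg_apply, add_apply, mul_apply_eq_comp, inner_neg_right, inner_add_right, sub_apply,
      inner_sub_right, h6, one_apply_eq_self, real_inner_self_eq_norm_sq] at h1 h2
    simp only [map_add, map_smul, inner_add_left, inner_add_right, real_inner_smul_left,
      real_inner_smul_right, h7, h8] at h3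
    simp only [add_apply, smul_apply, sub_apply, mul_apply_eq_comp, inner_add_left,
      inner_sub_right, real_inner_smul_left]
    have h9 := mul_le_mul_of_nonneg_left h5 (mul_nonneg hε0.le hε0.le)
    have h10 := mul_le_mul_of_nonneg_right hεS (mul_nonneg hε0.le (sq_nonneg ‖x‖))
    nlinarith

/-- One step of the Kleinman iteration: it is solvable, and preserves positivity of the operator
and stability of the closed loop. -/
theorem exists_kleinman_step [FiniteDimensional ℝ X] (hA : IsExpStable A) (hS : S.IsPositive)
    (hQ : Q.IsPositive) {P' : X →L[ℝ] X} (hP' : IsSelfAdjoint P') (hst : IsExpStable (A - S * P')) :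
    ∃ P : X →L[ℝ] X, (P.IsPositive ∧ IsExpStable (A - S * P)) ∧
      ∀ T, star (A - S * P') * T + T * (A - S * P') + (Q + P' * S * P') = 0 ↔ T = P := by
  have hN := hQ.add (isPositive_mul_mul hS hP')
  obtain ⟨P, hPsa, hP⟩ := exists_lyapunov hst hN.isSelfAdjoint
  have hP1 := (hP P).2 rfl
  have hpos := isPositive_of_lyapunov hst hPsa hN hP1
  refine ⟨P, ⟨hpos, ?_⟩, fun T => by rw [← hP T, eq_neg_iff_add_eq_zero]⟩
  refine isExpStable_sub hA hS
    (hQ.add (isPositive_mul_mul hS (hPsa.sub hP'))) hpos ?_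
  rw [IsSelfAdjoint.star_sub_mul hS.isSelfAdjoint hP'] at hP1
  rw [IsSelfAdjoint.star_sub_mul hS.isSelfAdjoint hPsa]
  linear_combination (norm := noncomm_ring) hP1

/-- A step of the iteration decreases the operator once the current operator is itself the result
of a step. -/
theorem isPositive_sub_of_kleinman_step (hS : S.IsPositive) {P P' P'' : X →L[ℝ] X}
    (hP' : IsSelfAdjoint P') (hP : IsSelfAdjoint P) (hP'' : IsSelfAdjoint P'')
    (hst : IsExpStable (A - S * P))
    (h : star (A - S * P') * P + P * (A - S * P') + (Q + P' * S * P') = 0)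
    (h' : star (A - S * P) * P'' + P'' * (A - S * P) + (Q + P * S * P) = 0) :
    (P - P'').IsPositive := by
  refine isPositive_of_lyapunov hst (hP.sub hP'') (isPositive_mul_mul hS (hP.sub hP')) ?_
  rw [IsSelfAdjoint.star_sub_mul hS.isSelfAdjoint hP'] at h
  rw [IsSelfAdjoint.star_sub_mul hS.isSelfAdjoint hP] at h' ⊢
  linear_combination (norm := noncomm_ring) h - h'

/-- The Riccati equation `A* P + P A + Q - P S P = 0`, with `S` standing for `B R⁻¹ B*` and `Q` for
`C* C`. -/
def RiccatiEq (A S Q P : X →L[ℝ] X) : Prop := star A * P + P * A + Q - P * S * P = 0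

/-- The Riccati equation as a Lyapunov equation for the closed loop. -/
lemma RiccatiEq.closedLoop {P : X →L[ℝ] X} (h : RiccatiEq A S Q P) (hS : IsSelfAdjoint S)
    (hP : IsSelfAdjoint P) :
    star (A - S * P) * P + P * (A - S * P) = -(Q + P * S * P) := by
  rw [IsSelfAdjoint.star_sub_mul hS hP]
  unfold RiccatiEq at h
  linear_combination (norm := noncomm_ring) h

lemma RiccatiEq.isExpStable [FiniteDimensional ℝ X] {P : X →L[ℝ] X} (h : RiccatiEq A S Q P)
    (hA : IsExpStable A) (hS : S.IsPositive) (hQ : Q.IsPositive) (hP : P.IsPositive) :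
    IsExpStable (A - S * P) :=
  isExpStable_sub hA hS hQ hP (h.closedLoop hS.isSelfAdjoint hP.isSelfAdjoint)

/-- Positive solutions of the Riccati equation are unique: the difference of two of them solves a
Sylvester equation with both closed loops. -/
theorem RiccatiEq.unique [FiniteDimensional ℝ X] (hA : IsExpStable A) (hS : S.IsPositive)
    (hQ : Q.IsPositive) {P P' : X →L[ℝ] X} (hP : P.IsPositive) (hP' : P'.IsPositive)
    (h : RiccatiEq A S Q P) (h' : RiccatiEq A S Q P') : P = P' := by
  rw [← sub_eq_zero]
  refine eq_zero_of_sylvester (h.isExpStable hA hS hQ hP) (h'.isExpStable hA hS hQ hP') ?_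
  rw [IsSelfAdjoint.star_sub_mul hS.isSelfAdjoint hP.isSelfAdjoint]
  unfold RiccatiEq at h h'
  linear_combination (norm := noncomm_ring) h - h'

/-- The error recursion of the Newton iteration, as a Lyapunov equation for the limiting closed
loop. -/
lemma kleinman_error {P P₁ P₂ : X →L[ℝ] X} (hS : IsSelfAdjoint S) (hP : IsSelfAdjoint P)
    (hP₁ : IsSelfAdjoint P₁) (h : RiccatiEq A S Q P)
    (h' : star (A - S * P₁) * P₂ + P₂ * (A - S * P₁) + (Q + P₁ * S * P₁) = 0) :
    star (A - S * P) * (P₂ - P) + (P₂ - P) * (A - S * P)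
      = (P₂ - P) * S * (P₂ - P) - (P₂ - P₁) * S * (P₂ - P₁) := by
  rw [IsSelfAdjoint.star_sub_mul hS hP₁] at h'
  rw [IsSelfAdjoint.star_sub_mul hS hP]
  unfold RiccatiEq at h
  linear_combination (norm := noncomm_ring) h' - h

/-- The Kleinman iteration started from the zero operator. The starting operator need not lie above
its successor, so monotonicity begins with `p 1`. -/
theorem exists_kleinman_seq [FiniteDimensional ℝ X] (hA : IsExpStable A) (hS : S.IsPositive)
    (hQ : Q.IsPositive) :
    ∃ p : ℕ → X →L[ℝ] X, p 0 = 0 ∧ (∀ n, (p n).IsPositive) ∧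
      (∀ n T, star (A - S * p n) * T + T * (A - S * p n) + (Q + p n * S * p n) = 0
        ↔ T = p (n + 1)) ∧
      (∀ n, (p (n + 1) - p (n + 2)).IsPositive) := by
  choose f hf hf' using fun P' : {P : X →L[ℝ] X // P.IsPositive ∧ IsExpStable (A - S * P)} =>
    exists_kleinman_step hA hS hQ P'.2.1.isSelfAdjoint P'.2.2
  let g : ℕ → {P : X →L[ℝ] X // P.IsPositive ∧ IsExpStable (A - S * P)} := fun n =>
    Nat.rec ⟨0, ContinuousLinearMap.isPositive_zero, by simpa using hA⟩ (fun _ P => ⟨f P, hf P⟩) n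
  have hg : ∀ n T, star (A - S * (g n).1) * T + T * (A - S * (g n).1)
      + (Q + (g n).1 * S * (g n).1) = 0 ↔ T = (g (n + 1)).1 := fun n => hf' (g n)
  refine ⟨fun n => (g n).1, rfl, fun n => (g n).2.1, hg, fun n => ?_⟩
  exact isPositive_sub_of_kleinman_step hS (g n).2.1.isSelfAdjoint (g (n + 1)).2.1.isSelfAdjoint
    (g (n + 2)).2.1.isSelfAdjoint (g (n + 1)).2.2 ((hg n _).2 rfl) ((hg (n + 1) _).2 rfl)

end Kleinman

/-! ### Convergence of the Kleinman iteration -/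

section KleinmanConvergence

lemma norm_mul_mul_self_le {X : Type*} [NormedAddCommGroup X] [NormedSpace ℝ X]
    (D S : X →L[ℝ] X) : ‖D * S * D‖ ≤ ‖S‖ * ‖D‖ ^ 2 := by
  calc ‖D * S * D‖ ≤ ‖D‖ * ‖S‖ * ‖D‖ := (norm_mul_le _ _).trans (by gcongr; exact norm_mul_le _ _)
    _ = _ := by ring

variable {X : Type*} [NormedAddCommGroup X] [InnerProductSpace ℝ X] [CompleteSpace X]
  [FiniteDimensional ℝ X] {A S Q : X →L[ℝ] X}

/-- The Kleinman iterates decrease to a positive solution of the Riccati equation, with quadratic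
rate both a priori and a posteriori. -/
theorem kleinman_convergence (hA : IsExpStable A) (hS : S.IsPositive) (hQ : Q.IsPositive)
    {p : ℕ → X →L[ℝ] X} (hpos : ∀ n, (p n).IsPositive)
    (heq : ∀ n T, star (A - S * p n) * T + T * (A - S * p n) + (Q + p n * S * p n) = 0
        ↔ T = p (n + 1))
    (hdec : ∀ n, (p (n + 1) - p (n + 2)).IsPositive) :
    ∃ P : X →L[ℝ] X, P.IsPositive ∧ RiccatiEq A S Q P ∧ Tendsto p atTop (𝓝 P) ∧
      (∀ n, (p (n + 1) - P).IsPositive) ∧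
      ∃ c : ℝ, ∀ n, ‖p (n + 2) - P‖ ≤ c * ‖p (n + 1) - P‖ ^ 2 ∧
        ‖p (n + 2) - P‖ ≤ c * ‖p (n + 2) - p (n + 1)‖ ^ 2 := by
  obtain ⟨P, hlim, hge⟩ := exists_tendsto_of_decreasing (fun n => hpos (n + 1)) hdec
  have hlim' : Tendsto p atTop (𝓝 P) := (tendsto_add_atTop_iff_nat 1).1 hlim
  have hPpos : P.IsPositive := isPositive_of_tendsto hlim' (Eventually.of_forall hpos)
  have hric : RiccatiEq A S Q P := by
    have h1 : Tendsto (fun n => star (A - S * p n) * p (n + 1) + p (n + 1) * (A - S * p n)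
        + (Q + p n * S * p n)) atTop
        (𝓝 (star (A - S * P) * P + P * (A - S * P) + (Q + P * S * P))) := by
      have h2 : Tendsto (fun n => A - S * p n) atTop (𝓝 (A - S * P)) :=
        tendsto_const_nhds.sub (tendsto_const_nhds.mul hlim')
      exact ((h2.star.mul hlim).add (hlim.mul h2)).add
        (tendsto_const_nhds.add ((hlim'.mul tendsto_const_nhds).mul hlim'))
    have h3 := tendsto_nhds_unique h1 (tendsto_const_nhds.congr fun n => ((heq n _).2 rfl).symm)
    rw [IsSelfAdjoint.star_sub_mul hS.isSelfAdjoint hPpos.isSelfAdjoint] at h3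
    unfold RiccatiEq
    linear_combination (norm := noncomm_ring) h3
  refine ⟨P, hPpos, hric, hlim', hge, ?_⟩
  obtain ⟨c, hc0, hc⟩ := exists_norm_le_lyapunovMap (hric.isExpStable hA hS hQ hPpos)
  have herr : ∀ n, ‖p (n + 2) - P‖ ≤
      c * (‖S‖ * ‖p (n + 2) - P‖ ^ 2 + ‖S‖ * ‖p (n + 2) - p (n + 1)‖ ^ 2) := by
    intro n
    refine (hc _).trans ?_
    rw [kleinman_error hS.isSelfAdjoint hPpos.isSelfAdjoint (hpos (n + 1)).isSelfAdjoint hric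
      ((heq (n + 1) _).2 rfl)]
    gcongr
    exact (norm_sub_le _ _).trans (add_le_add (norm_mul_mul_self_le _ _) (norm_mul_mul_self_le _ _))
  -- by monotonicity both errors on the right are at most `‖p (n + 1) - P‖`
  have hfirst : ∀ n, ‖p (n + 2) - P‖ ≤ (2 * c * ‖S‖) * ‖p (n + 1) - P‖ ^ 2 := by
    intro n
    have h1 : ‖p (n + 2) - P‖ ≤ ‖p (n + 1) - P‖ :=
      norm_le_norm_of_isPositive (hge (n + 1)) (by simpa using hdec n)
    have h2 : ‖p (n + 2) - p (n + 1)‖ ≤ ‖p (n + 1) - P‖ := by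
      rw [norm_sub_rev]
      exact norm_le_norm_of_isPositive (hdec n) (by simpa using hge (n + 1))
    refine (herr n).trans ?_
    calc _ ≤ c * (‖S‖ * ‖p (n + 1) - P‖ ^ 2 + ‖S‖ * ‖p (n + 1) - P‖ ^ 2) := by gcongr
      _ = _ := by ring
  -- eventually the first error term on the right is absorbed by the left-hand side
  have hsecond : ∃ c' : ℝ, ∀ n, ‖p (n + 2) - P‖ ≤ c' * ‖‖p (n + 2) - p (n + 1)‖ ^ 2‖ := by
    refine (Asymptotics.isBigO_nat_atTop_iff fun n hn => ?_).1 ?_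
    · -- a stationary point of the iteration solves the Riccati equation
      have h1 : p (n + 2) = p (n + 1) := by
        rw [← sub_eq_zero, ← norm_eq_zero]; exact pow_eq_zero_iff two_ne_zero |>.1 hn
      have h2 := (heq (n + 1) _).2 rfl
      rw [h1, IsSelfAdjoint.star_sub_mul hS.isSelfAdjoint (hpos _).isSelfAdjoint] at h2
      have h3 : RiccatiEq A S Q (p (n + 1)) := by
        unfold RiccatiEq
        linear_combination (norm := noncomm_ring) h2
      rw [h1, h3.unique hA hS hQ (hpos _) hPpos hric, sub_self]
    · refine Asymptotics.IsBigO.of_bound (2 * c * ‖S‖) ?_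
      have h1 : Tendsto (fun n => c * ‖S‖ * ‖p (n + 2) - P‖) atTop (𝓝 (c * ‖S‖ * 0)) :=
        (tendsto_iff_norm_sub_tendsto_zero.1 (hlim'.comp (tendsto_add_atTop_nat 2))).const_mul _
      rw [mul_zero] at h1
      filter_upwards [h1.eventually (gt_mem_nhds (show (0 : ℝ) < 1 / 2 by norm_num))] with n hn
      rw [Real.norm_of_nonneg (by positivity)]
      have h2 := herr n
      nlinarith [norm_nonneg (p (n + 2) - P)]
  obtain ⟨c', hc'⟩ := hsecond
  refine ⟨max (2 * c * ‖S‖) c', fun n => ⟨(hfirst n).trans ?_, (hc' n).trans ?_⟩⟩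
  · gcongr; exact le_max_left _ _
  · rw [Real.norm_of_nonneg (by positivity)]
    gcongr; exact le_max_right _ _

end KleinmanConvergence

/-! ### Gains, and positivity of the Riccati solution -/

section GainOperators

variable {X H U : Type*} [NormedAddCommGroup X] [InnerProductSpace ℝ X] [CompleteSpace X]
  [NormedAddCommGroup H] [InnerProductSpace ℝ H] [CompleteSpace H]
  [NormedAddCommGroup U] [InnerProductSpace ℝ U] [CompleteSpace U]

/-- Observability makes positive Riccati solutions strictly positive: the kernel of such a
solution is invariant under `A` and annihilated by `C`. -/
theorem RiccatiEq.isPosDefOp {A S P : X →L[ℝ] X} {C : X →L[ℝ] H} (hAC : IsObservable A C)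
    (h : RiccatiEq A S (ContinuousLinearMap.adjoint C ∘L C) P) (hP : P.IsPositive) :
    IsPosDefOp P := by
  have hker : ∀ x, P x = 0 → C x = 0 ∧ P (A x) = 0 := by
    intro x hx
    have h1 := congrArg (fun T : X →L[ℝ] X => T x) h
    simp only [add_apply, sub_apply, mul_apply_eq_comp, ContinuousLinearMap.comp_apply, hx,
      map_zero, zero_add, sub_zero, zero_apply] at h1
    have h2 := congrArg (fun y => inner ℝ x y) h1
    simp only [inner_add_right, ContinuousLinearMap.adjoint_inner_right, inner_zero_right] at h2
    rw [← hP.isSelfAdjoint.inner_apply_comm, hx, inner_zero_left, zero_add] at h2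
    have h3 := inner_self_eq_zero.1 h2
    rw [h3, map_zero, add_zero] at h1
    exact ⟨h3, h1⟩
  refine ⟨hP.isSelfAdjoint, fun x hx => lt_of_le_of_ne (hP.inner_nonneg_right x) fun h0 => hx ?_⟩
  have hPx : P x = 0 := hP.apply_eq_zero (by rw [real_inner_comm]; exact h0.symm)
  have hpow : ∀ n : ℕ, P ((A ^ n) x) = 0 := by
    intro n
    induction n with
    | zero => simpa using hPx
    | succ n ih => rw [pow_succ', mul_apply_eq_comp]; exact (hker _ ih).2
  refine hAC x fun t _ => ?_
  have hsum := NormedSpace.exp_series_hasSum_exp' (𝕂 := ℝ) (t • A)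
  have hsum2 := (C.hasSum ((ContinuousLinearMap.apply ℝ X x).hasSum hsum))
  refine hsum2.unique ?_
  convert hasSum_zero using 2 with n
  simp only [ContinuousLinearMap.apply_apply, smul_pow, map_smul, (hker _ (hpow n)).1,
    smul_zero]

variable {R : U →L[ℝ] U}

/-- The operator `B R⁻¹ B*`, the quadratic coefficient of the Riccati equation. The inverse is a
`Ring.inverse`, to agree with `gain`; it is a true inverse if `R` is positive definite. -/
noncomputable def controlOp (B : U →L[ℝ] X) (R : U →L[ℝ] U) : X →L[ℝ] X :=
  B ∘L Ring.inverse R ∘L ContinuousLinearMap.adjoint B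

lemma comp_gain (B : U →L[ℝ] X) (R : U →L[ℝ] U) (P : X →L[ℝ] X) :
    B ∘L gain B R P = controlOp B R * P := rfl

lemma IsPosDefOp.isUnit [FiniteDimensional ℝ U] (hR : IsPosDefOp R) : IsUnit R := by
  rw [ContinuousLinearMap.isUnit_iff_bijective]
  have hinj : Function.Injective R := (injective_iff_map_eq_zero R).2 fun x hx => by
    by_contra hne
    have := hR.2 x hne
    rw [hx, inner_zero_right] at this
    exact lt_irrefl _ this
  exact ⟨hinj, (LinearMap.injective_iff_surjective (f := (R : U →ₗ[ℝ] U))).1 hinj⟩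

lemma IsPosDefOp.isPositive (hR : IsPosDefOp R) : R.IsPositive := by
  rw [ContinuousLinearMap.isPositive_iff']
  refine ⟨hR.1, fun x => ?_⟩
  rcases eq_or_ne x 0 with rfl | hx
  · simp
  · rw [real_inner_comm]; exact (hR.2 x hx).le

lemma IsPosDefOp.apply_inverse [FiniteDimensional ℝ U] (hR : IsPosDefOp R) (u : U) :
    R (Ring.inverse R u) = u := by
  have := congrArg (fun T : U →L[ℝ] U => T u) (Ring.mul_inverse_cancel R hR.isUnit)
  simpa using this

lemma IsPosDefOp.isSelfAdjoint_inverse [FiniteDimensional ℝ U] (hR : IsPosDefOp R) :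
    IsSelfAdjoint (Ring.inverse R) := by
  rw [IsSelfAdjoint, ← Ring.inverse_star, hR.1.star_eq]

lemma IsPosDefOp.isPositive_inverse [FiniteDimensional ℝ U] (hR : IsPosDefOp R) :
    (Ring.inverse R).IsPositive := by
  rw [ContinuousLinearMap.isPositive_iff']
  refine ⟨hR.isSelfAdjoint_inverse, fun u => ?_⟩
  have := hR.isPositive.inner_nonneg_right (Ring.inverse R u)
  rwa [hR.apply_inverse] at this

lemma isPositive_controlOp [FiniteDimensional ℝ U] (B : U →L[ℝ] X) (hR : IsPosDefOp R) :
    (controlOp B R).IsPositive :=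
  hR.isPositive_inverse.conj_adjoint B

lemma adjoint_gain_comp_gain [FiniteDimensional ℝ U] (B : U →L[ℝ] X) (hR : IsPosDefOp R)
    {P : X →L[ℝ] X} (hP : IsSelfAdjoint P) :
    ContinuousLinearMap.adjoint (gain B R P) ∘L R ∘L gain B R P = P * controlOp B R * P := by
  ext x
  refine ext_inner_left ℝ fun y => ?_
  simp only [gain, controlOp, ContinuousLinearMap.comp_apply, mul_apply_eq_comp,
    ContinuousLinearMap.adjoint_inner_right, hR.apply_inverse]
  rw [← hP.inner_apply_comm y, ← ContinuousLinearMap.adjoint_inner_right B,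
    hR.isSelfAdjoint_inverse.inner_apply_comm, ContinuousLinearMap.adjoint_inner_left]

lemma isLyapunovSolution_gain_iff [FiniteDimensional ℝ U] {A : X →L[ℝ] X} {B : U →L[ℝ] X}
    {C : X →L[ℝ] H} (hR : IsPosDefOp R) {P : X →L[ℝ] X} (hP : IsSelfAdjoint P) (T : X →L[ℝ] X) :
    IsLyapunovSolution A B C R (gain B R P) T ↔
      star (A - controlOp B R * P) * T + T * (A - controlOp B R * P)
        + (ContinuousLinearMap.adjoint C ∘L C + P * controlOp B R * P) = 0 := by
  rw [IsLyapunovSolution, adjoint_gain_comp_gain B hR hP, comp_gain, add_assoc]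
  rfl

lemma isRiccatiSolution_iff {A : X →L[ℝ] X} {B : U →L[ℝ] X} {C : X →L[ℝ] H} (P : X →L[ℝ] X) :
    IsRiccatiSolution A B C R P ↔
      RiccatiEq A (controlOp B R) (ContinuousLinearMap.adjoint C ∘L C) P := Iff.rfl

lemma gain_zero (B : U →L[ℝ] X) (R : U →L[ℝ] U) : gain B R 0 = 0 := by
  simp [gain]

/-- The gains of the shifted sequence `P_k = p (k + 1)`: since `p 0 = 0`, the initial gain `0` is
the gain of `p 0`. -/
lemma iterGain_succ_shift (B : U →L[ℝ] X) (R : U →L[ℝ] U) {p : ℕ → X →L[ℝ] X} (hp : p 0 = 0)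
    (k : ℕ) : iterGain B R (fun k => p (k + 1)) k = gain B R (p k) := by
  cases k with
  | zero => rw [hp, gain_zero]; rfl
  | succ k => rfl

end GainOperators

/-! ### Absolutely continuous paths and variation of constants -/

section Paths

/-- Product rule for primitives of integrable real functions. -/
lemma integral_mul_primitive {a b : ℝ → ℝ} {T : ℝ} (α β : ℝ)
    (ha : IntervalIntegrable a volume 0 T) (hb : IntervalIntegrable b volume 0 T) :
    ∫ t in (0 : ℝ)..T, (a t * (β + ∫ s in (0 : ℝ)..t, b s) + (α + ∫ s in (0 : ℝ)..t, a s) * b t)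
      = (α + ∫ s in (0 : ℝ)..T, a s) * (β + ∫ s in (0 : ℝ)..T, b s) - α * β := by
  have hac : ∀ (c : ℝ → ℝ) (γ : ℝ), IntervalIntegrable c volume 0 T →
      AbsolutelyContinuousOnInterval (fun t => γ + ∫ s in (0 : ℝ)..t, c s) 0 T := by
    intro c γ hc
    have h1 : AbsolutelyContinuousOnInterval (fun _ : ℝ => γ) 0 T :=
      (LipschitzWith.const γ).lipschitzOnWith.absolutelyContinuousOnInterval (K := 0)
    exact h1.add (hc.absolutelyContinuousOnInterval_intervalIntegral Set.left_mem_uIcc)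
  have h := (hac a α ha).integral_deriv_mul_eq_sub (hac b β hb)
  simp only [intervalIntegral.integral_same, add_zero] at h
  rw [← h]
  refine intervalIntegral.integral_congr_ae ?_
  filter_upwards [ha.ae_hasDerivAt_integral, hb.ae_hasDerivAt_integral] with t hat hbt ht
  have ht' := Set.uIoc_subset_uIcc ht
  rw [((hat ht' 0 Set.left_mem_uIcc).const_add α).deriv,
    ((hbt ht' 0 Set.left_mem_uIcc).const_add β).deriv]

variable {X : Type*} [NormedAddCommGroup X] [InnerProductSpace ℝ X] [CompleteSpace X]

/-- The energy identity `d⟨P Y, Y⟩ = 2 ⟨P Y, Y'⟩ dt` along an absolutely continuous path. -/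
lemma inner_primitive_eq [FiniteDimensional ℝ X] {P : X →L[ℝ] X} (hP : IsSelfAdjoint P)
    {f : ℝ → X} {T : ℝ} (x : X) (hf : IntervalIntegrable f volume 0 T) :
    inner ℝ (P (x + ∫ s in (0 : ℝ)..T, f s)) (x + ∫ s in (0 : ℝ)..T, f s)
      = inner ℝ (P x) x
        + ∫ t in (0 : ℝ)..T, 2 * inner ℝ (P (x + ∫ s in (0 : ℝ)..t, f s)) (f t) := by
  let b := stdOrthonormalBasis ℝ X
  have hint : ∀ (φ : X →L[ℝ] ℝ), IntervalIntegrable (fun t => φ (f t)) volume 0 T := fun φ =>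
    ⟨φ.integrable_comp hf.1, φ.integrable_comp hf.2⟩
  have hcomm : ∀ (φ : X →L[ℝ] ℝ) (t : ℝ), t ∈ Set.uIcc 0 T →
      φ (x + ∫ s in (0 : ℝ)..t, f s) = φ x + ∫ s in (0 : ℝ)..t, φ (f s) := by
    intro φ t ht
    rw [map_add, ContinuousLinearMap.intervalIntegral_comp_comm]
    exact hf.mono_set (Set.uIcc_subset_uIcc Set.left_mem_uIcc ht)
  let φ : Fin (Module.finrank ℝ X) → X →L[ℝ] ℝ := fun i => innerSL ℝ (b i)
  have hφ : ∀ i y, φ i y = inner ℝ (b i) y := fun i y => rfl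
  have hexp : ∀ y z : X, inner ℝ (P y) z = ∑ i, (φ i ∘L P) y * φ i z := by
    intro y z
    rw [← b.sum_inner_mul_inner]
    refine Finset.sum_congr rfl fun i _ => ?_
    rw [ContinuousLinearMap.comp_apply, hφ, hφ, real_inner_comm]
  have hscalar : ∀ i, (φ i ∘L P) (x + ∫ s in (0 : ℝ)..T, f s) * φ i (x + ∫ s in (0 : ℝ)..T, f s)
      - (φ i ∘L P) x * φ i x = ∫ t in (0 : ℝ)..T,
        ((φ i ∘L P) (f t) * φ i (x + ∫ s in (0 : ℝ)..t, f s)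
          + (φ i ∘L P) (x + ∫ s in (0 : ℝ)..t, f s) * φ i (f t)) := by
    intro i
    rw [hcomm _ T Set.right_mem_uIcc, hcomm _ T Set.right_mem_uIcc,
      ← integral_mul_primitive _ _ (hint _) (hint _)]
    refine intervalIntegral.integral_congr fun t ht => ?_
    simp only [hcomm _ t ht]
  have hii : ∀ i, IntervalIntegrable (fun t =>
      (φ i ∘L P) (f t) * φ i (x + ∫ s in (0 : ℝ)..t, f s)
          + (φ i ∘L P) (x + ∫ s in (0 : ℝ)..t, f s) * φ i (f t)) volume 0 T := by
    intro i
    have hc : ContinuousOn (fun t => x + ∫ s in (0 : ℝ)..t, f s) (Set.uIcc 0 T) :=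
      continuousOn_const.add (intervalIntegral.continuousOn_primitive_interval' hf
        Set.left_mem_uIcc)
    exact ((hint _).mul_continuousOn ((φ i).continuous.comp_continuousOn hc)).add
      ((hint _).continuousOn_mul ((φ i ∘L P).continuous.comp_continuousOn hc))
  rw [hexp, hexp x x, ← sub_eq_iff_eq_add', ← Finset.sum_sub_distrib]
  simp_rw [hscalar]
  rw [← intervalIntegral.integral_finsetSum fun i _ => hii i]
  refine intervalIntegral.integral_congr fun t _ => ?_
  simp only [Finset.sum_add_distrib, ← hexp]
  rw [hP.inner_apply_comm (f t), real_inner_comm]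
  ring

/-- The solution of `y' = M (y + h)`, `y(0) = x` by variation of constants. Then `z = y + h` solves
`z = x + ∫ M z + h`, which makes sense for paths `h` that are merely continuous. -/
noncomputable def vocSolution (M : X →L[ℝ] X) (x : X) (h : ℝ → X) (t : ℝ) : X :=
  NormedSpace.exp (t • M) (x + ∫ s in (0 : ℝ)..t, NormedSpace.exp ((-s) • M) (M (h s)))

lemma continuous_exp_smul (M : X →L[ℝ] X) : Continuous fun t : ℝ => NormedSpace.exp (t • M) :=
  continuous_iff_continuousAt.2 fun t => (hasDerivAt_exp_smul_const (𝕂 := ℝ) M t).continuousAt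

lemma exp_smul_mul_exp_neg_smul (M : X →L[ℝ] X) (t : ℝ) :
    NormedSpace.exp (t • M) * NormedSpace.exp ((-t) • M) = 1 := by
  let _ : NormedAlgebra ℚ (X →L[ℝ] X) := .restrictScalars ℚ ℝ _
  rw [neg_smul, ← NormedSpace.exp_add_of_commute, add_neg_cancel, NormedSpace.exp_zero]
  exact (Commute.refl _).neg_right

lemma continuous_vocIntegrand (M : X →L[ℝ] X) {h : ℝ → X} (hh : Continuous h) :
    Continuous fun s : ℝ => NormedSpace.exp ((-s) • M) (M (h s)) :=
  ((continuous_exp_smul M).comp continuous_neg).clm_apply (M.continuous.comp hh)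

lemma hasDerivAt_vocSolution (M : X →L[ℝ] X) (x : X) {h : ℝ → X} (hh : Continuous h) (t : ℝ) :
    HasDerivAt (vocSolution M x h) (M (vocSolution M x h t + h t)) t := by
  have hc := continuous_vocIntegrand M hh
  have h1 : HasDerivAt (fun t => x + ∫ s in (0 : ℝ)..t, NormedSpace.exp ((-s) • M) (M (h s)))
      (NormedSpace.exp ((-t) • M) (M (h t))) t :=
    (intervalIntegral.integral_hasDerivAt_right (hc.intervalIntegrable _ _)
      (hc.stronglyMeasurableAtFilter _ _) hc.continuousAt).const_add x
  refine ((hasDerivAt_exp_smul_const' (𝕂 := ℝ) M t).clm_apply h1).congr_deriv ?_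
  rw [← mul_apply_eq_comp (NormedSpace.exp (t • M)), exp_smul_mul_exp_neg_smul]
  simp only [vocSolution, map_add, mul_apply_eq_comp, one_apply_eq_self]

lemma vocSolution_zero {X : Type*} [NormedAddCommGroup X] [InnerProductSpace ℝ X]
    (M : X →L[ℝ] X) (x : X) (h : ℝ → X) : vocSolution M x h 0 = x := by
  simp [vocSolution]

lemma continuous_vocSolution (M : X →L[ℝ] X) (x : X) {h : ℝ → X} (hh : Continuous h) :
    Continuous (vocSolution M x h) :=
  continuous_iff_continuousAt.2 fun t => (hasDerivAt_vocSolution M x hh t).continuousAt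

lemma vocSolution_eq_integral (M : X →L[ℝ] X) (x : X) {h : ℝ → X} (hh : Continuous h) (t : ℝ) :
    vocSolution M x h t = x + ∫ s in (0 : ℝ)..t, M (vocSolution M x h s + h s) := by
  have hc : Continuous fun s => M (vocSolution M x h s + h s) :=
    M.continuous.comp ((continuous_vocSolution M x hh).add hh)
  rw [intervalIntegral.integral_eq_sub_of_hasDerivAt (fun s _ => hasDerivAt_vocSolution M x hh s)
    (hc.intervalIntegrable _ _), vocSolution_zero, add_sub_cancel]

/-- Uniqueness for the linear Volterra equation `z = x + ∫ M z + h`. -/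
lemma eq_vocSolution (M : X →L[ℝ] X) (x : X) {h z : ℝ → X} (hh : Continuous h) (hz : Continuous z)
    (heq : ∀ t, 0 ≤ t → z t = x + (∫ s in (0 : ℝ)..t, M (z s)) + h t) {t : ℝ} (ht : 0 ≤ t) :
    z t = vocSolution M x h t + h t := by
  set v : ℝ → X := fun t => x + ∫ s in (0 : ℝ)..t, M (z s) with hv
  have hc : Continuous fun s => M (z s) := M.continuous.comp hz
  have hv' : ∀ s, HasDerivAt v (M (z s)) s := fun s =>
    (intervalIntegral.integral_hasDerivAt_right (hc.intervalIntegrable _ _)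
      (hc.stronglyMeasurableAtFilter _ _) hc.continuousAt).const_add x
  set g : ℝ → X := fun s => NormedSpace.exp ((-s) • M) (v s - vocSolution M x h s) with hg
  have hexp : ∀ s : ℝ, HasDerivAt (fun s : ℝ => NormedSpace.exp ((-s) • M))
      (-(NormedSpace.exp ((-s) • M) * M)) s := by
    intro s
    have := (hasDerivAt_exp_smul_const (𝕂 := ℝ) M (-s)).scomp s (hasDerivAt_neg s)
    refine this.congr_deriv ?_
    rw [neg_smul, one_smul]
  have hg' : ∀ s, 0 ≤ s → HasDerivAt g 0 s := by
    intro s hs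
    refine ((hexp s).clm_apply ((hv' s).sub (hasDerivAt_vocSolution M x hh s))).congr_deriv ?_
    have h1 : M (z s) = M (vocSolution M x h s + h s) + M (v s - vocSolution M x h s) := by
      rw [heq s hs, ← map_add]
      congr 1
      simp only [hv]
      abel
    rw [Pi.sub_apply, h1, neg_apply, mul_apply_eq_comp, add_sub_cancel_left, neg_add_cancel]
  have hconst := constant_of_has_deriv_right_zero (a := 0) (b := t)
    (fun s hs => (hg' s hs.1).continuousAt.continuousWithinAt)
    (fun s hs => (hg' s hs.1).hasDerivWithinAt) t ⟨ht, le_rfl⟩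
  have h0 : g 0 = 0 := by simp [hg, hv, vocSolution_zero]
  rw [h0] at hconst
  have h1 : v t - vocSolution M x h t = 0 := by
    have h2 := congrArg (fun L : X →L[ℝ] X => L (v t - vocSolution M x h t))
      (exp_smul_mul_exp_neg_smul M t)
    simp only [mul_apply_eq_comp, one_apply_eq_self] at h2
    rw [← h2, show NormedSpace.exp ((-t) • M) (v t - vocSolution M x h t) = 0 from hconst, map_zero]
  rw [heq t ht, ← sub_eq_zero.1 h1]

/-- The bound is by the `L¹` norm of `h`, whose expectation is under control when `h` is random. -/
lemma norm_vocSolution_le (M : X →L[ℝ] X) (T : ℝ) : ∃ c : ℝ, 0 ≤ c ∧ ∀ (x : X) (h : ℝ → X),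
    Continuous h → ∀ t ∈ Set.Icc 0 T,
      ‖vocSolution M x h t‖ ≤ c * (‖x‖ + ∫ s in (0 : ℝ)..T, ‖h s‖) := by
  obtain ⟨e, he⟩ := (isCompact_Icc (a := -|T|) (b := |T|)).exists_bound_of_continuousOn
    (continuous_exp_smul M).continuousOn
  have he0 : 0 ≤ e := (norm_nonneg _).trans (he 0 (by simp))
  refine ⟨e * (1 + e * ‖M‖), by positivity, fun x h hh t ht => ?_⟩
  have hT : 0 ≤ T := ht.1.trans ht.2
  have hI : ‖∫ s in (0 : ℝ)..t, NormedSpace.exp ((-s) • M) (M (h s))‖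
      ≤ e * ‖M‖ * ∫ s in (0 : ℝ)..T, ‖h s‖ := by
    calc _ ≤ ∫ s in (0 : ℝ)..t, e * ‖M‖ * ‖h s‖ := by
          refine intervalIntegral.norm_integral_le_of_norm_le ht.1 ?_
            ((hh.norm.const_mul _).intervalIntegrable _ _)
          refine Eventually.of_forall fun s hs => ?_
          refine (ContinuousLinearMap.le_opNorm _ _).trans ?_
          rw [mul_assoc]
          refine mul_le_mul (he _ ?_) (M.le_opNorm _) (norm_nonneg _) he0
          rw [abs_of_nonneg hT]
          constructor <;> linarith [hs.1, hs.2, ht.2]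
      _ = e * ‖M‖ * ∫ s in (0 : ℝ)..t, ‖h s‖ := intervalIntegral.integral_const_mul _ _
      _ ≤ _ := by
          gcongr
          exact intervalIntegral.integral_mono_interval le_rfl ht.1 ht.2
            (Eventually.of_forall fun _ => norm_nonneg _) (hh.norm.intervalIntegrable _ _)
  have hI0 : 0 ≤ ∫ s in (0 : ℝ)..T, ‖h s‖ :=
    intervalIntegral.integral_nonneg hT fun _ _ => norm_nonneg _
  calc ‖vocSolution M x h t‖ ≤ e * (‖x‖ + e * ‖M‖ * ∫ s in (0 : ℝ)..T, ‖h s‖) := by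
        refine (ContinuousLinearMap.le_opNorm _ _).trans ?_
        refine mul_le_mul (he _ ?_) ((norm_add_le _ _).trans (by gcongr)) (norm_nonneg _) he0
        rw [abs_of_nonneg hT]
        constructor <;> linarith [ht.1, ht.2]
    _ ≤ _ := by
        have : 0 ≤ e * ‖M‖ := by positivity
        rw [mul_assoc e (1 + e * ‖M‖)]
        refine mul_le_mul_of_nonneg_left ?_ he0
        nlinarith [norm_nonneg x, mul_nonneg this (norm_nonneg x)]

end Paths

/-! ### Square integrable processes -/

section ProductSpace

variable {Ω : Type*} [mΩ : MeasurableSpace Ω] {μ : Measure Ω}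
  {E : Type*} [NormedAddCommGroup E]

/-- The product measure on `(0, T) × Ω`, carried by `ℝ × Ω`; it is zero if `T ≤ 0`. -/
noncomputable abbrev timeProd (μ : Measure Ω) (T : ℝ) : Measure (ℝ × Ω) :=
  (volume.restrict (Set.Ioo 0 T)).prod μ

/-- A process, as a function on `ℝ × Ω`. It is frozen at time `0` for negative times. -/
def uncurried (f : ℝ≥0 → Ω → E) : ℝ × Ω → E := fun p => f p.1.toNNReal p.2

lemma IsAEAdapted.aestronglyMeasurable {F : Filtration ℝ≥0 mΩ} {f : ℝ≥0 → Ω → E}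
    (hf : IsAEAdapted μ F f) (t : ℝ≥0) : AEStronglyMeasurable (f t) μ := by
  obtain ⟨g, hg, h⟩ := hf t
  exact ⟨g, hg.mono (F.le t), h⟩

/-- A process with a.s. continuous paths agrees, off a null set, with one all of whose paths are
continuous and all of whose marginals are measurable. -/
lemma exists_continuous_version {Z : ℝ≥0 → Ω → E} (hZ : ∀ t, AEStronglyMeasurable (Z t) μ)
    (hc : ∀ᵐ ω ∂μ, Continuous fun t => Z t ω) :
    ∃ Z' : ℝ≥0 → Ω → E, (∀ ω, Continuous fun t => Z' t ω) ∧ (∀ t, StronglyMeasurable (Z' t)) ∧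
      ∀ᵐ ω ∂μ, ∀ t, Z' t ω = Z t ω := by
  classical
  obtain ⟨D, hDc, hDd⟩ := TopologicalSpace.exists_countable_dense ℝ≥0
  have hev : ∀ᵐ ω ∂μ, Continuous (fun t => Z t ω) ∧ ∀ q ∈ D, Z q ω = (hZ q).mk _ ω := by
    refine hc.and ((ae_ball_iff hDc).2 fun q _ => (hZ q).ae_eq_mk)
  obtain ⟨G, hG, hGm, hGp⟩ := hev.exists_measurable_mem
  refine ⟨fun t => G.indicator (Z t), fun ω => ?_, fun t => ?_, ?_⟩
  · by_cases hω : ω ∈ G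
    · simpa [Set.indicator_of_mem hω] using (hGp ω hω).1
    · simp [Set.indicator_of_notMem hω, continuous_const]
  · have hq : ∀ q ∈ D, StronglyMeasurable (G.indicator (Z q)) := by
      intro q hq
      have : G.indicator (Z q) = G.indicator ((hZ q).mk _) :=
        Set.indicator_congr fun ω hω => (hGp ω hω).2 q hq
      rw [this]
      exact (hZ q).stronglyMeasurable_mk.indicator hGm
    obtain ⟨x, hx, hxt⟩ := mem_closure_iff_seq_limit.1 (hDd t)
    refine stronglyMeasurable_of_tendsto atTop (fun n => hq _ (hx n)) ?_
    rw [tendsto_pi_nhds]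
    intro ω
    by_cases hω : ω ∈ G
    · simpa [Set.indicator_of_mem hω, Function.comp_def] using
        ((hGp ω hω).1.tendsto t).comp hxt
    · simp [Set.indicator_of_notMem hω]
  · filter_upwards [hG] with ω hω t using Set.indicator_of_mem hω _

/-- Joint measurability of processes with continuous paths. -/
lemma aestronglyMeasurable_uncurried {Z : ℝ≥0 → Ω → E} (hZ : ∀ t, AEStronglyMeasurable (Z t) μ)
    (hc : ∀ᵐ ω ∂μ, Continuous fun t => Z t ω) (ν : Measure ℝ) [SFinite ν] :
    AEStronglyMeasurable (uncurried Z) (ν.prod μ) := by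
  obtain ⟨Z', hZ'c, hZ'm, hZ'⟩ := exists_continuous_version hZ hc
  have h1 := stronglyMeasurable_uncurry_of_continuous_of_stronglyMeasurable hZ'c hZ'm
  refine ⟨_, h1.comp_measurable ((measurable_real_toNNReal.comp measurable_fst).prodMk
    measurable_snd), ?_⟩
  filter_upwards [Measure.quasiMeasurePreserving_snd.ae hZ'] with p hp
  exact (hp _).symm

variable [IsProbabilityMeasure μ]

lemma sqNormOmegaT_eq_lintegral {T : ℝ} {f : ℝ≥0 → Ω → E}
    (hf : AEStronglyMeasurable (uncurried f) (timeProd μ T)) :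
    sqNormOmegaT μ T f = ∫⁻ p, ‖uncurried f p‖ₑ ^ 2 ∂timeProd μ T := by
  rw [lintegral_prod_symm _ (hf.enorm.pow_const 2)]
  rfl

lemma memLp_uncurried_iff {T : ℝ} {f : ℝ≥0 → Ω → E}
    (hf : AEStronglyMeasurable (uncurried f) (timeProd μ T)) :
    MemLp (uncurried f) 2 (timeProd μ T) ↔ sqNormOmegaT μ T f < ∞ := by
  rw [MemLp, eLpNorm_lt_top_iff_lintegral_rpow_enorm_lt_top two_ne_zero ENNReal.ofNat_ne_top,
    sqNormOmegaT_eq_lintegral hf]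
  simp [hf]

lemma sqNormOmegaT_eq_ofReal {T : ℝ} {f : ℝ≥0 → Ω → E}
    (hf : MemLp (uncurried f) 2 (timeProd μ T)) :
    sqNormOmegaT μ T f = ENNReal.ofReal (∫ p, ‖uncurried f p‖ ^ 2 ∂timeProd μ T) := by
  rw [sqNormOmegaT_eq_lintegral hf.1, ofReal_integral_eq_lintegral_ofReal hf.norm.integrable_sq
    (Eventually.of_forall fun _ => sq_nonneg _)]
  refine lintegral_congr fun p => ?_
  rw [ENNReal.ofReal_pow (norm_nonneg _), ofReal_norm]

variable {F : Filtration ℝ≥0 mΩ}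

lemma IsAdmissible.memLp {f : ℝ≥0 → Ω → E} (hf : IsAdmissible μ F f) (T : ℝ) :
    MemLp (uncurried f) 2 (timeProd μ T) := by
  have hm : AEStronglyMeasurable (uncurried f) (timeProd μ T) :=
    hf.measurable.mono_ac
      ((Measure.restrict_mono_set _ Set.Ioo_subset_Ioi_self).absolutelyContinuous.prod .rfl)
  rcases le_or_gt T 0 with hT | hT
  · simp [timeProd, Set.Ioo_eq_empty_of_le hT]
  · exact (memLp_uncurried_iff hm).2 (hf.square_integrable T hT)

lemma IsAdmissible.ae_memLp_path {f : ℝ≥0 → Ω → E} (hf : IsAdmissible μ F f) :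
    ∀ᵐ ω ∂μ, ∀ T : ℝ, MemLp (fun t : ℝ => f t.toNNReal ω) 2 (volume.restrict (Set.Ioo 0 T)) := by
  have h1 : ∀ᵐ ω ∂μ, ∀ n : ℕ,
      MemLp (fun t : ℝ => f t.toNNReal ω) 2 (volume.restrict (Set.Ioo 0 (n : ℝ))) := by
    refine ae_all_iff.2 fun n => ?_
    have h2 := hf.memLp n
    filter_upwards [h2.1.prodMk_right, h2.norm.integrable_sq.prod_left_ae] with ω h3 h4
    exact (memLp_two_iff_integrable_sq_norm h3).2 h4
  filter_upwards [h1] with ω h T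
  obtain ⟨n, hn⟩ := exists_nat_ge T
  exact (h n).mono_measure (Measure.restrict_mono_set _ (Set.Ioo_subset_Ioo_right hn))

lemma intervalIntegrable_of_memLp {g : ℝ → E} {T : ℝ} (hT : 0 ≤ T)
    (hg : MemLp g 2 (volume.restrict (Set.Ioo 0 T))) : IntervalIntegrable g volume 0 T := by
  rw [intervalIntegrable_iff_integrableOn_Ioo_of_le hT]
  exact hg.integrable one_le_two

end ProductSpace

/-! ### Moments of the Wiener process -/

section Wiener

variable {Ω : Type*} [mΩ : MeasurableSpace Ω] {μ : Measure Ω} {d : ℕ}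
  {F : Filtration ℝ≥0 mΩ} {W : ℝ≥0 → Ω → EuclideanSpace ℝ (Fin d)}

lemma IsWiener.stronglyMeasurable (hW : IsWiener μ F W) (t : ℝ≥0) : StronglyMeasurable (W t) :=
  (hW.adapted t).mono (F.le t)

lemma IsWiener.ae_continuous (hW : IsWiener μ F W) : ∀ᵐ ω ∂μ, Continuous fun t => W t ω := by
  filter_upwards [ae_all_iff.2 fun i => (hW.brownian i).cont] with ω h
  exact (PiLp.continuous_toLp 2 _).comp (continuous_pi h)

lemma IsWiener.ae_zero (hW : IsWiener μ F W) : ∀ᵐ ω ∂μ, W 0 ω = 0 := by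
  filter_upwards [ae_all_iff.2 fun i => (hW.brownian i).eval_zero_ae_eq_zero] with ω h
  ext i
  exact h i

lemma IsWiener.memLp_coord (hW : IsWiener μ F W) (t : ℝ≥0) (i : Fin d) :
    MemLp (fun ω => W t ω i) 2 μ :=
  let h := (hW.brownian i).hasLaw_eval t
  (h.map_eq ▸ memLp_id_gaussianReal 2 : MemLp id 2 (μ.map fun ω => W t ω i)).comp_of_map
    h.aemeasurable

lemma IsWiener.memLp (hW : IsWiener μ F W) (t : ℝ≥0) : MemLp (W t) 2 μ :=
  MemLp.of_eval_piLp (hW.memLp_coord t)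

lemma IsWiener.integral_mul_coord (hW : IsWiener μ F W) (t : ℝ≥0) (i j : Fin d) :
    ∫ ω, W t ω i * W t ω j ∂μ = if i = j then (t : ℝ) else 0 := by
  split_ifs with h
  · subst h
    have h1 := (hW.brownian i).covariance_fun_eval t t
    rw [covariance_self (hW.memLp_coord t i).1.aemeasurable, variance_of_integral_eq_zero
      (hW.memLp_coord t i).1.aemeasurable ((hW.brownian i).integral_eval t)] at h1
    simpa [sq] using h1
  · have h1 : IndepFun (fun ω => W t ω i) (fun ω => W t ω j) μ :=
      (hW.indep_coord.indepFun h).comp (measurable_pi_apply t) (measurable_pi_apply t)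
    rw [h1.integral_fun_mul_eq_mul_integral (hW.memLp_coord t i).1 (hW.memLp_coord t j).1]
    have h2 := (hW.brownian i).integral_eval t
    rw [h2, zero_mul]

lemma IsWiener.integral_eq_zero [IsProbabilityMeasure μ] (hW : IsWiener μ F W) (t : ℝ≥0) :
    ∫ ω, W t ω ∂μ = 0 := by
  ext i
  rw [eval_integral_piLp fun j => (hW.memLp_coord t j).integrable one_le_two]
  exact (hW.brownian i).integral_eval t

variable {X : Type*} [NormedAddCommGroup X] [InnerProductSpace ℝ X]

/-- The second moment of the noise `K W_t`, measured by `P`, per unit of time: the trace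
of `K* P K`. -/
noncomputable def noiseTrace (K : EuclideanSpace ℝ (Fin d) →L[ℝ] X) (P : X →L[ℝ] X) : ℝ :=
  ∑ i, inner ℝ (P (K (EuclideanSpace.single i 1))) (K (EuclideanSpace.single i 1))

lemma IsWiener.integral_inner (hW : IsWiener μ F W) (K : EuclideanSpace ℝ (Fin d) →L[ℝ] X)
    (P : X →L[ℝ] X) (t : ℝ≥0) :
    ∫ ω, inner ℝ (P (K (W t ω))) (K (W t ω)) ∂μ = noiseTrace K P * t := by
  have hexp : ∀ w : EuclideanSpace ℝ (Fin d), w = ∑ i, w i • EuclideanSpace.single i (1 : ℝ) := by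
    intro w
    ext j
    simp [Finset.sum_apply, Pi.single_apply]
  have h1 : ∀ ω, inner ℝ (P (K (W t ω))) (K (W t ω)) = ∑ i, ∑ j, (W t ω i * W t ω j) *
      inner ℝ (P (K (EuclideanSpace.single i 1))) (K (EuclideanSpace.single j 1)) := by
    intro ω
    conv_lhs => rw [hexp (W t ω)]
    simp only [map_sum, map_smul, sum_inner, inner_sum, real_inner_smul_left,
      real_inner_smul_right]
    rw [Finset.sum_comm]
    refine Finset.sum_congr rfl fun i _ => Finset.sum_congr rfl fun j _ => ?_
    ring
  have hint : ∀ i j, Integrable (fun ω => (W t ω i * W t ω j) *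
      inner ℝ (P (K (EuclideanSpace.single i 1))) (K (EuclideanSpace.single j 1))) μ :=
    fun i j => ((hW.memLp_coord t i).integrable_mul (hW.memLp_coord t j)).mul_const _
  simp_rw [h1]
  rw [integral_finsetSum _ fun i _ => integrable_finsetSum _ fun j _ => hint i j]
  simp_rw [integral_finsetSum _ fun j _ => hint _ j, integral_mul_const, hW.integral_mul_coord]
  simp [noiseTrace, Finset.mul_sum, mul_comm]

/-- Increments of the noise are orthogonal to the past. -/
lemma IsWiener.integral_inner_increment [CompleteSpace X] [IsProbabilityMeasure μ]
    (hW : IsWiener μ F W) (K : EuclideanSpace ℝ (Fin d) →L[ℝ] X) {s t : ℝ≥0} (hst : s ≤ t)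
    {g : Ω → X}
    (hg : AEStronglyMeasurable[F s] g μ) (hg2 : Integrable g μ) :
    ∫ ω, inner ℝ (g ω) (K (W t ω) - K (W s ω)) ∂μ = 0 := by
  borelize X
  obtain ⟨g', hg'm, hg'⟩ := hg
  have hind : IndepFun g' (fun ω => W t ω - W s ω) μ := by
    rw [IndepFun_iff_Indep]
    exact indep_of_indep_of_le_left (hW.indep_increment s t hst) hg'm.measurable.comap_le
  have hI : Integrable (fun ω => W t ω - W s ω) μ :=
    ((hW.memLp t).integrable one_le_two).sub ((hW.memLp s).integrable one_le_two)
  have hK : ∫ ω, K (W t ω - W s ω) ∂μ = 0 := by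
    rw [K.integral_comp_comm hI, integral_sub ((hW.memLp t).integrable one_le_two)
      ((hW.memLp s).integrable one_le_two), hW.integral_eq_zero, hW.integral_eq_zero, sub_zero,
      map_zero]
  have h1 := (hind.comp measurable_id K.continuous.measurable).integral_bilin (hg2.congr hg')
    (K.integrable_comp hI) (innerSL ℝ)
  simp only [Function.comp_def, hK, map_zero, id] at h1
  refine (integral_congr_ae ?_).trans h1
  filter_upwards [hg'] with ω hω
  rw [hω, ← map_sub]
  rfl

end Wiener

/-! ### Square integrability of controlled Ornstein-Uhlenbeck processes -/

section OrnsteinUhlenbeck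

variable {Ω : Type*} [mΩ : MeasurableSpace Ω] {μ : Measure Ω} {d : ℕ}
  {F : Filtration ℝ≥0 mΩ} {W : ℝ≥0 → Ω → EuclideanSpace ℝ (Fin d)}
  {X U : Type*} [NormedAddCommGroup X] [InnerProductSpace ℝ X]
  [NormedAddCommGroup U] [InnerProductSpace ℝ U]
  {M : X →L[ℝ] X} {B : U →L[ℝ] X} {K : EuclideanSpace ℝ (Fin d) →L[ℝ] X} {ξ : Ω → X}
  {u : ℝ≥0 → Ω → U} {Z : ℝ≥0 → Ω → X}

lemma IsOUProcess.aestronglyMeasurable (hZ : IsOUProcess μ F M B K W ξ u Z) (T : ℝ) :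
    AEStronglyMeasurable (uncurried Z) (timeProd μ T) :=
  aestronglyMeasurable_uncurried (fun t => hZ.adapted.aestronglyMeasurable t) hZ.continuous _

/-- The Cauchy-Schwarz inequality against a constant. -/
lemma sq_integral_le {g : ℝ → ℝ} {T : ℝ} (hT : 0 < T)
    (hg : MemLp g 2 (volume.restrict (Set.Ioo 0 T))) :
    (∫ t in Set.Ioo 0 T, g t) ^ 2 ≤ T * ∫ t in Set.Ioo 0 T, g t ^ 2 := by
  set I := ∫ t in Set.Ioo 0 T, g t
  have h1 : Integrable g (volume.restrict (Set.Ioo 0 T)) := hg.integrable one_le_two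
  have h2 : ∫ t in Set.Ioo 0 T, (2 * (I / T) * g t - (I / T) ^ 2)
      ≤ ∫ t in Set.Ioo 0 T, g t ^ 2 := by
    refine integral_mono ((h1.const_mul _).sub (integrable_const _)) hg.integrable_sq fun t => ?_
    -- `I / T` is the mean of `g`
    nlinarith [sq_nonneg (I / T - g t)]
  rw [integral_sub (h1.const_mul _) (integrable_const _), integral_const_mul] at h2
  simp only [integral_const, MeasurableSet.univ, measureReal_restrict_apply, Set.univ_inter,
    Real.volume_real_Ioo_of_le hT.le, sub_zero, smul_eq_mul] at h2
  have h3 : 2 * (I / T) * I - T * (I / T) ^ 2 = I ^ 2 / T := by field_simp; ring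
  rw [h3, div_le_iff₀ hT] at h2
  linarith

/-- The time integral of the norm of a process in `L²(Ω × (0,T))` is square integrable. -/
lemma memLp_integral_norm [IsProbabilityMeasure μ] {E : Type*} [NormedAddCommGroup E]
    {f : ℝ≥0 → Ω → E} {T : ℝ} (hf : MemLp (uncurried f) 2 (timeProd μ T)) :
    MemLp (fun ω => ∫ t in Set.Ioo 0 T, ‖f t.toNNReal ω‖) 2 μ := by
  rcases le_or_gt T 0 with hT | hT
  · simp [Set.Ioo_eq_empty_of_le hT]
  have hm : AEStronglyMeasurable (fun ω => ∫ t in Set.Ioo 0 T, ‖f t.toNNReal ω‖) μ :=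
    hf.norm.1.prod_swap.integral_prod_right'
  rw [memLp_two_iff_integrable_sq hm]
  have hi := hf.norm.integrable_sq
  refine (hi.integral_prod_right.const_mul T).mono' (hm.pow 2) ?_
  filter_upwards [hf.norm.1.prodMk_right, hi.prod_left_ae] with ω h1 h2
  rw [Real.norm_of_nonneg (sq_nonneg _)]
  exact sq_integral_le hT ((memLp_two_iff_integrable_sq h1).2 h2)

lemma intervalIntegrable_comp_toNNReal {E : Type*} [NormedAddCommGroup E] {g : ℝ≥0 → E}
    (hg : ∀ T : ℝ, 0 ≤ T → IntervalIntegrable (fun t : ℝ => g t.toNNReal) volume 0 T) (a b : ℝ) :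
    IntervalIntegrable (fun t : ℝ => g t.toNNReal) volume a b := by
  have h : ∀ T : ℝ, IntervalIntegrable (fun t : ℝ => g t.toNNReal) volume 0 T := by
    intro T
    rcases le_or_gt 0 T with hT | hT
    · exact hg T hT
    · refine (intervalIntegrable_const (c := g 0)).congr fun t ht => ?_
      rw [Set.uIoc_of_ge hT.le] at ht
      rw [Real.toNNReal_of_nonpos ht.2]
  exact (h a).symm.trans (h b)

variable [CompleteSpace X]

/-- A controlled Ornstein-Uhlenbeck path in terms of the variation of constants formula. -/
lemma IsOUProcess.ae_eq_vocSolution [IsProbabilityMeasure μ] (hW : IsWiener μ F W)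
    (hu : IsAdmissible μ F u) (hZ : IsOUProcess μ F M B K W ξ u Z) :
    ∀ᵐ ω ∂μ, ∃ h : ℝ → X, Continuous h ∧
      (∀ t, h t = (∫ s in (0 : ℝ)..t, B (u s.toNNReal ω)) + K (W t.toNNReal ω)) ∧
      ∀ t, 0 ≤ t → Z t.toNNReal ω = vocSolution M (ξ ω) h t + h t := by
  filter_upwards [hZ.continuous, hZ.equation, hu.ae_memLp_path, hW.ae_continuous]
    with ω hZc hZe huω hWc
  have hui : ∀ a b : ℝ, IntervalIntegrable (fun t : ℝ => B (u t.toNNReal ω)) volume a b :=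
    fun a b => intervalIntegrable_comp_toNNReal (g := fun t => B (u t ω)) (fun T hT =>
      intervalIntegrable_of_memLp hT (B.comp_memLp' (huω T))) a b
  have hc : Continuous fun t : ℝ => Z t.toNNReal ω := hZc.comp continuous_real_toNNReal
  have hh : Continuous fun t : ℝ => (∫ s in (0 : ℝ)..t, B (u s.toNNReal ω)) + K (W t.toNNReal ω) :=
    (intervalIntegral.continuous_primitive hui 0).add
      (K.continuous.comp (hWc.comp continuous_real_toNNReal))
  refine ⟨_, hh, fun t => rfl, fun t ht => eq_vocSolution M (ξ ω) hh hc (fun t ht => ?_) ht⟩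
  have hMc : Continuous fun t : ℝ => M (Z t.toNNReal ω) := M.continuous.comp hc
  have := hZe t.toNNReal
  rw [Real.coe_toNNReal t ht, intervalIntegral.integral_add
    (hMc.intervalIntegrable _ _) (hui _ _)] at this
  rw [this]
  simp only [add_assoc]

/-- A bound for the paths on `[0, T]` by quantities that are square integrable. -/
lemma IsOUProcess.exists_norm_le [IsProbabilityMeasure μ] (hW : IsWiener μ F W)
    (hu : IsAdmissible μ F u) (hZ : IsOUProcess μ F M B K W ξ u Z) (T : ℝ) :
    ∃ c : ℝ, ∀ᵐ ω ∂μ, ∀ t ∈ Set.Icc 0 T, ‖Z t.toNNReal ω‖ ≤ ‖K‖ * ‖W t.toNNReal ω‖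
      + c * (‖ξ ω‖ + (∫ s in Set.Ioo 0 T, ‖u s.toNNReal ω‖)
        + ∫ s in Set.Ioo 0 T, ‖W s.toNNReal ω‖) := by
  obtain ⟨c, hc0, hc⟩ := norm_vocSolution_le M T
  refine ⟨‖B‖ + c * (1 + T * ‖B‖ + ‖K‖), ?_⟩
  filter_upwards [hZ.ae_eq_vocSolution hW hu, hu.ae_memLp_path, hW.ae_continuous]
    with ω ⟨h, hh, hht, hZe⟩ huω hWc t ht
  have hT : 0 ≤ T := ht.1.trans ht.2
  set I := ∫ s in Set.Ioo 0 T, ‖u s.toNNReal ω‖ with hI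
  set V := ∫ s in Set.Ioo 0 T, ‖W s.toNNReal ω‖ with hV
  have hI0 : 0 ≤ I := integral_nonneg fun _ => norm_nonneg _
  have hV0 : 0 ≤ V := integral_nonneg fun _ => norm_nonneg _
  have hWcont : Continuous fun s : ℝ => ‖W s.toNNReal ω‖ :=
    (hWc.comp continuous_real_toNNReal).norm
  have hun : IntervalIntegrable (fun s : ℝ => ‖u s.toNNReal ω‖) volume 0 T :=
    intervalIntegrable_of_memLp hT (huω T).norm
  have hhn : ∀ s ∈ Set.Icc 0 T, ‖h s‖ ≤ ‖B‖ * I + ‖K‖ * ‖W s.toNNReal ω‖ := by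
    intro s hs
    rw [hht]
    refine (norm_add_le _ _).trans (add_le_add ?_ (K.le_opNorm _))
    calc ‖∫ r in (0 : ℝ)..s, B (u r.toNNReal ω)‖ ≤ ∫ r in (0 : ℝ)..s, ‖B‖ * ‖u r.toNNReal ω‖ := by
          refine intervalIntegral.norm_integral_le_of_norm_le hs.1
            (Eventually.of_forall fun r _ => B.le_opNorm _) ?_
          exact (hun.mono_set (Set.uIcc_subset_uIcc Set.left_mem_uIcc
            (by rwa [Set.uIcc_of_le hT]))).const_mul _
      _ ≤ ∫ r in (0 : ℝ)..T, ‖B‖ * ‖u r.toNNReal ω‖ :=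
          intervalIntegral.integral_mono_interval le_rfl hs.1 hs.2
            (Eventually.of_forall fun _ => by positivity) (hun.const_mul _)
      _ = ‖B‖ * I := by
          rw [intervalIntegral.integral_const_mul, intervalIntegral.integral_of_le hT,
            integral_Ioc_eq_integral_Ioo]
  have hint : ∫ s in (0 : ℝ)..T, ‖h s‖ ≤ T * (‖B‖ * I) + ‖K‖ * V := by
    calc ∫ s in (0 : ℝ)..T, ‖h s‖
        ≤ ∫ s in (0 : ℝ)..T, (‖B‖ * I + ‖K‖ * ‖W s.toNNReal ω‖) :=
          intervalIntegral.integral_mono_on hT (hh.norm.intervalIntegrable _ _)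
            ((continuous_const.add (hWcont.const_mul _)).intervalIntegrable _ _) hhn
      _ = T * (‖B‖ * I) + ‖K‖ * V := by
          rw [intervalIntegral.integral_add (by simp) ((hWcont.const_mul _).intervalIntegrable _ _),
            intervalIntegral.integral_const, intervalIntegral.integral_const_mul,
            intervalIntegral.integral_of_le hT, integral_Ioc_eq_integral_Ioo, sub_zero, smul_eq_mul]
  rw [hZe t ht.1]
  calc ‖vocSolution M (ξ ω) h t + h t‖
      ≤ c * (‖ξ ω‖ + (T * (‖B‖ * I) + ‖K‖ * V)) + (‖B‖ * I + ‖K‖ * ‖W t.toNNReal ω‖) := by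
        refine (norm_add_le _ _).trans (add_le_add ((hc _ h hh t ht).trans ?_) (hhn t ht))
        gcongr
    _ ≤ _ := by
        have h1 : 0 ≤ c * ‖K‖ := by positivity
        have h2 : 0 ≤ c * (T * ‖B‖) := by positivity
        have h3 := norm_nonneg (ξ ω)
        have h4 := norm_nonneg B
        nlinarith [mul_nonneg h1 hI0, mul_nonneg h1 h3, mul_nonneg h2 hV0, mul_nonneg h2 h3,
          mul_nonneg h4 hV0, mul_nonneg h4 h3, mul_nonneg hc0 hI0, mul_nonneg hc0 hV0]

lemma IsWiener.memLp_uncurried [IsProbabilityMeasure μ] (hW : IsWiener μ F W) (T : ℝ) :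
    MemLp (uncurried W) 2 (timeProd μ T) := by
  have hm : AEStronglyMeasurable (uncurried W) (timeProd μ T) :=
    aestronglyMeasurable_uncurried (fun t => (hW.stronglyMeasurable t).aestronglyMeasurable)
      hW.ae_continuous _
  rw [memLp_two_iff_integrable_sq_norm hm]
  refine (integrable_prod_iff (hm.norm.pow 2)).2 ?_
  have hsq : ∀ t : ℝ≥0, ∫ ω, ‖W t ω‖ ^ 2 ∂μ = d * t := by
    intro t
    have h1 := hW.integral_inner (.id ℝ _) (.id ℝ _) t
    simpa [noiseTrace, PiLp.norm_single] using h1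
  refine ⟨Eventually.of_forall fun t => (hW.memLp t.toNNReal).norm.integrable_sq, ?_⟩
  have h2 : (fun t : ℝ => ∫ ω, ‖((fun p => ‖uncurried W p‖) ^ 2) (t, ω)‖ ∂μ)
      = fun t => d * (t.toNNReal : ℝ) := by
    ext t
    rw [← hsq]
    simp [uncurried]
  rw [h2]
  have h3 : Continuous fun t : ℝ => (d : ℝ) * (t.toNNReal : ℝ) := by fun_prop
  exact (h3.integrableOn_Icc (a := 0) (b := T)).mono_set Set.Ioo_subset_Icc_self

variable [IsProbabilityMeasure μ]

/-- A controlled Ornstein-Uhlenbeck process is square integrable. -/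
lemma IsOUProcess.memLp_uncurried (hW : IsWiener μ F W) (hξ2 : MemLp ξ 2 μ)
    (hu : IsAdmissible μ F u) (hZ : IsOUProcess μ F M B K W ξ u Z) (T : ℝ) :
    MemLp (uncurried Z) 2 (timeProd μ T) := by
  obtain ⟨c, hc⟩ := hZ.exists_norm_le hW hu T
  have h1 : MemLp (fun p : ℝ × Ω => ‖K‖ * ‖uncurried W p‖ + c * (‖ξ p.2‖
      + (∫ s in Set.Ioo 0 T, ‖u s.toNNReal p.2‖) + ∫ s in Set.Ioo 0 T, ‖W s.toNNReal p.2‖))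
      2 (timeProd μ T) := by
    have h2 := ((hξ2.norm.add (memLp_integral_norm (hu.memLp T))).add
      (memLp_integral_norm (hW.memLp_uncurried T))).const_mul c
    exact ((hW.memLp_uncurried T).norm.const_mul _).add (h2.comp_snd _)
  refine h1.mono' (hZ.aestronglyMeasurable T) ?_
  have h3 : ∀ᵐ p : ℝ × Ω ∂timeProd μ T, p.1 ∈ Set.Ioo 0 T :=
    Measure.quasiMeasurePreserving_fst.ae (ae_restrict_mem measurableSet_Ioo)
  filter_upwards [Measure.quasiMeasurePreserving_snd.ae hc, h3] with p hp hp1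
  exact hp p.1 (Set.Ioo_subset_Icc_self hp1)

lemma IsOUProcess.memLp (hW : IsWiener μ F W) (hξ2 : MemLp ξ 2 μ)
    (hu : IsAdmissible μ F u) (hZ : IsOUProcess μ F M B K W ξ u Z) (t : ℝ≥0) :
    MemLp (Z t) 2 μ := by
  obtain ⟨c, hc⟩ := hZ.exists_norm_le hW hu t
  have h2 := ((hξ2.norm.add (memLp_integral_norm (hu.memLp t))).add
      (memLp_integral_norm (hW.memLp_uncurried t))).const_mul c
  refine (((hW.memLp t).norm.const_mul ‖K‖).add h2).mono' (hZ.adapted.aestronglyMeasurable t) ?_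
  filter_upwards [hc] with ω hω
  simpa using! hω t ⟨t.2, le_rfl⟩

end OrnsteinUhlenbeck

/-! ### The energy identity -/

section EnergyIdentity

variable {Ω : Type*} [mΩ : MeasurableSpace Ω] {μ : Measure Ω} [IsProbabilityMeasure μ] {d : ℕ}
  {F : Filtration ℝ≥0 mΩ} {W : ℝ≥0 → Ω → EuclideanSpace ℝ (Fin d)}
  {X U : Type*} [NormedAddCommGroup X] [InnerProductSpace ℝ X]
  [NormedAddCommGroup U] [InnerProductSpace ℝ U]
  {K : EuclideanSpace ℝ (Fin d) →L[ℝ] X} {ξ : Ω → X} {f Z : ℝ≥0 → Ω → X}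

lemma integrable_inner {α : Type*} [MeasurableSpace α] {ν : Measure α} {g h : α → X}
    (hg : MemLp g 2 ν) (hh : MemLp h 2 ν) : Integrable (fun a => inner ℝ (g a) (h a)) ν := by
  refine (hg.norm.integrable_mul hh.norm).mono' (hg.1.inner hh.1) ?_
  exact Eventually.of_forall fun a => norm_inner_le_norm _ _

variable [CompleteSpace X] [FiniteDimensional ℝ X]

/-- The expectation of Itô's formula for the quadratic form of `P` along `dZ = f dt + K dW`. With
additive noise it follows from the product rule for `Z - K W`, since the increments of the noise
are orthogonal to the past values of `f`. -/
theorem energy_identity (hW : IsWiener μ F W) (hξ : AEStronglyMeasurable[F 0] ξ μ)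
    (hξ2 : MemLp ξ 2 μ) (hf : IsAdmissible μ F f)
    (hZ : ∀ᵐ ω ∂μ, ∀ t : ℝ≥0, Z t ω = ξ ω + (∫ s in (0 : ℝ)..t, f s.toNNReal ω) + K (W t ω))
    (hZ2 : ∀ T : ℝ, MemLp (uncurried Z) 2 (timeProd μ T))
    {P : X →L[ℝ] X} (hP : IsSelfAdjoint P) (T : ℝ≥0) :
    ∫ ω, inner ℝ (P (Z T ω)) (Z T ω) ∂μ = ∫ ω, inner ℝ (P (ξ ω)) (ξ ω) ∂μ
      + ∫ p, 2 * inner ℝ (P (uncurried Z p)) (uncurried f p) ∂timeProd μ T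
      + noiseTrace K P * T := by
  have hT : (0 : ℝ) ≤ T := T.2
  have hKWT : MemLp (fun ω => K (W T ω)) 2 μ := K.comp_memLp' (hW.memLp T)
  have hPξ : MemLp (fun ω => P (ξ ω)) 2 μ := P.comp_memLp' hξ2
  have hPf : MemLp (fun p => P (uncurried f p)) 2 (timeProd μ T) := P.comp_memLp' (hf.memLp T)
  have hKW : MemLp (fun p => K (uncurried W p)) 2 (timeProd μ T) :=
    K.comp_memLp' (hW.memLp_uncurried T)
  -- integrability of the four terms
  have hi1 : Integrable (fun p => 2 * inner ℝ (P (uncurried Z p)) (uncurried f p))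
      (timeProd μ T) := (integrable_inner (P.comp_memLp' (hZ2 T)) (hf.memLp T)).const_mul 2
  have hi2 : Integrable (fun p : ℝ × Ω =>
      2 * inner ℝ (P (uncurried f p)) (K (W T p.2) - K (uncurried W p))) (timeProd μ T) :=
    (integrable_inner hPf
      ((hKWT.comp_snd (volume.restrict (Set.Ioo (0 : ℝ) T))).sub hKW)).const_mul 2
  have hi3 : Integrable (fun ω => 2 * inner ℝ (P (ξ ω)) (K (W T ω))) μ :=
    (integrable_inner hPξ hKWT).const_mul 2
  have hi4 : Integrable (fun ω => inner ℝ (P (K (W T ω))) (K (W T ω))) μ :=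
    integrable_inner (P.comp_memLp' hKWT) hKWT
  have hi0 : Integrable (fun ω => inner ℝ (P (ξ ω)) (ξ ω)) μ := integrable_inner hPξ hξ2
  -- the pathwise identity
  have hpath : ∀ᵐ ω ∂μ, inner ℝ (P (Z T ω)) (Z T ω) = inner ℝ (P (ξ ω)) (ξ ω)
      + (∫ t in Set.Ioo (0 : ℝ) T, 2 * inner ℝ (P (uncurried Z (t, ω))) (uncurried f (t, ω)))
      + (∫ t in Set.Ioo (0 : ℝ) T,
          2 * inner ℝ (P (uncurried f (t, ω))) (K (W T ω) - K (uncurried W (t, ω))))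
      + 2 * inner ℝ (P (ξ ω)) (K (W T ω)) + inner ℝ (P (K (W T ω))) (K (W T ω)) := by
    filter_upwards [hZ, hf.ae_memLp_path, hi1.prod_left_ae, hi2.prod_left_ae] with ω hZω hfω h1 h2
    have hfi := intervalIntegrable_of_memLp hT (hfω T)
    set Y : ℝ → X := fun t => ξ ω + ∫ s in (0 : ℝ)..t, f s.toNNReal ω with hY
    have hE := inner_primitive_eq hP (ξ ω) hfi
    have hZY : ∀ t : ℝ, 0 ≤ t → Z t.toNNReal ω = Y t + K (W t.toNNReal ω) := by
      intro t ht
      rw [hZω, Real.coe_toNNReal t ht]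
    have hYT : inner ℝ (P (Y T)) (K (W T ω)) = inner ℝ (P (ξ ω)) (K (W T ω))
        + ∫ t in Set.Ioo (0 : ℝ) T, inner ℝ (P (f t.toNNReal ω)) (K (W T ω)) := by
      have h3 : IntegrableOn (fun t : ℝ => P (f t.toNNReal ω)) (Set.Ioo 0 (T : ℝ)) :=
        P.integrable_comp ((hfω T).integrable one_le_two)
      simp only [hY, map_add, inner_add_left]
      congr 1
      rw [← ContinuousLinearMap.intervalIntegral_comp_comm P hfi,
        intervalIntegral.integral_of_le hT,
        integral_Ioc_eq_integral_Ioo, real_inner_comm, ← integral_inner h3]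
      exact integral_congr_ae (Eventually.of_forall fun t => real_inner_comm _ _)
    have hsum : (∫ t in Set.Ioo (0 : ℝ) T,
          2 * inner ℝ (P (uncurried Z (t, ω))) (uncurried f (t, ω)))
        + (∫ t in Set.Ioo (0 : ℝ) T,
          2 * inner ℝ (P (uncurried f (t, ω))) (K (W T ω) - K (uncurried W (t, ω))))
        = (∫ t in (0 : ℝ)..T, 2 * inner ℝ (P (Y t)) (f t.toNNReal ω))
          + 2 * ∫ t in Set.Ioo (0 : ℝ) T, inner ℝ (P (f t.toNNReal ω)) (K (W T ω)) := by
      have h3 : Integrable (fun t : ℝ => 2 * inner ℝ (P (f t.toNNReal ω)) (K (W T ω)))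
          (volume.restrict (Set.Ioo 0 (T : ℝ))) :=
        ((P.integrable_comp ((hfω T).integrable one_le_two)).inner_const _).const_mul 2
      have h4 : ∀ t ∈ Set.Ioo (0 : ℝ) T,
          2 * inner ℝ (P (uncurried Z (t, ω))) (uncurried f (t, ω))
          + 2 * inner ℝ (P (uncurried f (t, ω))) (K (W T ω) - K (uncurried W (t, ω)))
          - 2 * inner ℝ (P (f t.toNNReal ω)) (K (W T ω))
          = 2 * inner ℝ (P (Y t)) (f t.toNNReal ω) := by
        intro t ht
        simp only [uncurried, hZY t ht.1.le, map_add, inner_add_left, inner_sub_right]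
        rw [hP.inner_apply_comm (f _ ω) (K (W t.toNNReal ω)),
          real_inner_comm (P (K (W t.toNNReal ω))) (f t.toNNReal ω)]
        ring
      rw [← integral_add h1 h2, ← integral_const_mul, ← sub_eq_iff_eq_add,
        ← integral_sub (h1.fun_add h2) h3,
        intervalIntegral.integral_of_le hT, integral_Ioc_eq_integral_Ioo]
      exact setIntegral_congr_fun measurableSet_Ioo h4
    have hcross : inner ℝ (P (K (W T ω))) (Y T) = inner ℝ (P (Y T)) (K (W T ω)) := by
      rw [hP.inner_apply_comm, real_inner_comm]
    have hZT := hZω T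
    rw [show ξ ω + (∫ s in (0 : ℝ)..T, f s.toNNReal ω) = Y T from rfl] at hZT hE
    rw [hZT]
    simp only [map_add, inner_add_left, inner_add_right, hcross]
    rw [add_assoc (inner ℝ (P (ξ ω)) (ξ ω)) _ (∫ t in Set.Ioo (0 : ℝ) T,
          2 * inner ℝ (P (uncurried f (t, ω))) (K (W T ω) - K (uncurried W (t, ω)))), hsum, hE, hYT]
    ring
  -- the two martingale terms have zero mean
  have hz1 : ∫ ω, 2 * inner ℝ (P (ξ ω)) (K (W T ω)) ∂μ = 0 := by
    obtain ⟨ξ', hξ'm, hξ'⟩ := hξ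
    have h1 := hW.integral_inner_increment K (zero_le : 0 ≤ T) (g := fun ω => P (ξ ω))
      ⟨fun ω => P (ξ' ω), P.continuous.comp_stronglyMeasurable hξ'm,
        hξ'.fun_comp P⟩ (hPξ.integrable one_le_two)
    rw [integral_const_mul, mul_eq_zero]
    right
    rw [← h1]
    refine integral_congr_ae ?_
    filter_upwards [hW.ae_zero] with ω hω
    rw [hω, map_zero, sub_zero]
  have hz2 : ∫ p, 2 * inner ℝ (P (uncurried f p)) (K (W T p.2) - K (uncurried W p))
      ∂timeProd μ T = 0 := by
    rw [integral_prod _ hi2]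
    refine integral_eq_zero_of_ae ?_
    filter_upwards [ae_restrict_mem measurableSet_Ioo, (hf.memLp T).1.prodMk_left,
      (hf.memLp T).norm.integrable_sq.prod_right_ae] with t ht h1 h2
    have h3 : MemLp (f t.toNNReal) 2 μ := (memLp_two_iff_integrable_sq_norm h1).2 h2
    have h4 : t.toNNReal ≤ T := by
      rw [← NNReal.coe_le_coe, Real.coe_toNNReal t ht.1.le]; exact ht.2.le
    obtain ⟨f', hf'm, hf'⟩ := hf.adapted t.toNNReal
    have h5 := hW.integral_inner_increment K h4 (g := fun ω => P (f t.toNNReal ω))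
      ⟨fun ω => P (f' ω), P.continuous.comp_stronglyMeasurable hf'm, hf'.fun_comp P⟩
      (P.integrable_comp (h3.integrable one_le_two))
    simp only [uncurried, integral_const_mul, h5, mul_zero, Pi.zero_apply]
  have hj1 := hi1.integral_prod_right
  have hj2 := hi2.integral_prod_right
  rw [integral_congr_ae hpath, integral_add (((hi0.fun_add hj1).fun_add hj2).fun_add hi3) hi4,
    integral_add ((hi0.fun_add hj1).fun_add hj2) hi3, integral_add (hi0.fun_add hj1) hj2,
    integral_add hi0 hj1, ← integral_prod_symm _ hi1, ← integral_prod_symm _ hi2, hz1, hz2,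
    hW.integral_inner]
  ring

end EnergyIdentity

/-! ### Operations on admissible controls -/

section Admissible

variable {Ω : Type*} [mΩ : MeasurableSpace Ω] {μ : Measure Ω} {F : Filtration ℝ≥0 mΩ}
  {E V : Type*} [NormedAddCommGroup E]

lemma isAdmissible_zero : IsAdmissible μ F (0 : ℝ≥0 → Ω → E) where
  measurable := aestronglyMeasurable_const
  adapted _ := ⟨0, stronglyMeasurable_const, .rfl⟩
  square_integrable T _ := by simp [sqNormOmegaT]

lemma IsAEAdapted.clm_comp [NormedSpace ℝ E] [NormedAddCommGroup V] [NormedSpace ℝ V]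
    {f : ℝ≥0 → Ω → E} (hf : IsAEAdapted μ F f) (L : E →L[ℝ] V) :
    IsAEAdapted μ F fun t ω => L (f t ω) := by
  intro t
  obtain ⟨g, hg, h⟩ := hf t
  exact ⟨fun ω => L (g ω), L.continuous.comp_stronglyMeasurable hg, h.fun_comp L⟩

lemma IsAEAdapted.add {f g : ℝ≥0 → Ω → E} (hf : IsAEAdapted μ F f) (hg : IsAEAdapted μ F g) :
    IsAEAdapted μ F fun t ω => f t ω + g t ω := by
  intro t
  obtain ⟨f', hf', h⟩ := hf t
  obtain ⟨g', hg', h'⟩ := hg t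
  refine ⟨fun ω => f' ω + g' ω, hf'.add hg', ?_⟩
  filter_upwards [h, h'] with ω h1 h2
  rw [h1, h2]

/-- Admissibility from membership in `L²(Ω × (0,T))`. -/
lemma IsAdmissible.of_memLp [IsProbabilityMeasure μ] {f : ℝ≥0 → Ω → E}
    (hm : AEStronglyMeasurable (uncurried f) ((volume.restrict (Set.Ioi (0 : ℝ))).prod μ))
    (ha : IsAEAdapted μ F f) (hf : ∀ T : ℝ, MemLp (uncurried f) 2 (timeProd μ T)) :
    IsAdmissible μ F f :=
  ⟨hm, ha, fun T _ => (memLp_uncurried_iff (hf T).1).1 (hf T)⟩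

variable [IsProbabilityMeasure μ]

lemma IsAdmissible.clm_comp [NormedSpace ℝ E] [NormedAddCommGroup V] [NormedSpace ℝ V]
    {f : ℝ≥0 → Ω → E} (hf : IsAdmissible μ F f) (L : E →L[ℝ] V) :
    IsAdmissible μ F fun t ω => L (f t ω) :=
  .of_memLp (L.continuous.comp_aestronglyMeasurable hf.measurable) (hf.adapted.clm_comp L)
    fun T => L.comp_memLp' (hf.memLp T)

lemma IsAdmissible.add {f g : ℝ≥0 → Ω → E} (hf : IsAdmissible μ F f) (hg : IsAdmissible μ F g) :
    IsAdmissible μ F fun t ω => f t ω + g t ω :=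
  .of_memLp (hf.measurable.add hg.measurable) (hf.adapted.add hg.adapted)
    fun T => (hf.memLp T).add (hg.memLp T)

end Admissible

/-! ### Existence of processes under feedback -/

section Existence

variable {Ω : Type*} [mΩ : MeasurableSpace Ω] {μ : Measure Ω} {d : ℕ}
  {F : Filtration ℝ≥0 mΩ} {W : ℝ≥0 → Ω → EuclideanSpace ℝ (Fin d)}
  {X U : Type*} [NormedAddCommGroup X] [InnerProductSpace ℝ X]
  [NormedAddCommGroup U] [InnerProductSpace ℝ U]
  {B : U →L[ℝ] X} {K : EuclideanSpace ℝ (Fin d) →L[ℝ] X} {ξ : Ω → X}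

/-- Time integrals of a process with continuous paths are measurable with respect to the past.
The integrands are approximated by step functions sampled at times before `t`. -/
lemma aestronglyMeasurable_integral_of_past {E : Type*} [NormedAddCommGroup E]
    [NormedSpace ℝ E] [FiniteDimensional ℝ E] [CompleteSpace X] [FiniteDimensional ℝ X]
    {m : MeasurableSpace Ω} {V : ℝ≥0 → Ω → E} (t : ℝ≥0)
    (hV : ∀ s ≤ t, StronglyMeasurable[m] (V s)) (hc : ∀ᵐ ω ∂μ, Continuous fun s => V s ω)
    {φ : ℝ → E →L[ℝ] X} (hφ : Continuous φ) :
    AEStronglyMeasurable[m] (fun ω => ∫ s in (0 : ℝ)..t, φ s (V s.toNNReal ω)) μ := by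
  borelize E
  borelize X
  have : ProperSpace E := FiniteDimensional.proper ℝ E
  have : SecondCountableTopology E := inferInstance
  -- the sampling times
  let τ : ℕ → SimpleFunc ℝ ℝ≥0 := fun n =>
    SimpleFunc.approxOn Real.toNNReal measurable_real_toNNReal (Set.Iic t) 0
      (Set.mem_Iic.2 zero_le) n
  have hτt : ∀ n s, τ n s ≤ t := fun n s =>
    SimpleFunc.approxOn_mem measurable_real_toNNReal (s := Set.Iic t) _ n s
  have hτ : ∀ s : ℝ, s ≤ (t : ℝ) → Tendsto (fun n => τ n s) atTop (𝓝 s.toNNReal) :=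
    fun s hs => SimpleFunc.tendsto_approxOn measurable_real_toNNReal (s := Set.Iic t) _
      (subset_closure (Real.toNNReal_le_iff_le_coe.2 hs))
  let I : ℕ → Ω → X := fun n ω => ∫ s in (0 : ℝ)..t, φ s (V (τ n s) ω)
  have hI : ∀ n, StronglyMeasurable[m] (I n) := by
    intro n
    have h1 : @Measurable _ _ (@Prod.instMeasurableSpace ℝ Ω _ m) _
        (fun p : ℝ × Ω => V (τ n p.1) p.2) := by
      intro S hS
      have h2 : (fun p : ℝ × Ω => V (τ n p.1) p.2) ⁻¹' S
          = ⋃ r ∈ (τ n).range, (τ n ⁻¹' {r}) ×ˢ (V r ⁻¹' S) := by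
        ext p
        simp only [Set.mem_preimage, SimpleFunc.mem_range, Set.mem_range, Set.iUnion_exists,
          Set.iUnion_iUnion_eq', Set.mem_iUnion, Set.mem_prod, Set.mem_singleton_iff]
        exact ⟨fun h => ⟨p.1, rfl, h⟩, fun ⟨i, hi, h⟩ => hi ▸ h⟩
      rw [h2]
      exact Finset.measurableSet_biUnion _ fun r hr => by
        obtain ⟨s, rfl⟩ := SimpleFunc.mem_range.1 hr
        exact ((τ n).measurableSet_fiber _).prod ((hV _ (hτt n s)).measurable hS)
    have h4 : @StronglyMeasurable _ _ _ (@Prod.instMeasurableSpace Ω ℝ m _)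
        (Function.uncurry fun (ω : Ω) (s : ℝ) => φ s (V (τ n s) ω)) := by
      have h5 := h1.stronglyMeasurable.comp_measurable (@measurable_swap Ω ℝ m _)
      have h6 : @StronglyMeasurable _ _ _ (@Prod.instMeasurableSpace Ω ℝ m _)
          (fun p : Ω × ℝ => φ p.2) := hφ.stronglyMeasurable.comp_measurable measurable_snd
      exact (isBoundedBilinearMap_apply (𝕜 := ℝ)).continuous.comp_stronglyMeasurable
        (h6.prodMk h5)
    have h7 : I n = fun ω => ∫ s in Set.Ioc (0 : ℝ) t, φ s (V (τ n s) ω) := by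
      ext ω
      exact intervalIntegral.integral_of_le t.coe_nonneg
    rw [h7]
    exact h4.integral_prod_right
  refine ⟨_, StronglyMeasurable.limUnder (l := atTop) hI, ?_⟩
  filter_upwards [hc] with ω hω
  symm
  refine Tendsto.limUnder_eq ?_
  obtain ⟨b, hb⟩ := (isCompact_Icc (a := (0 : ℝ≥0)) (b := t)).exists_bound_of_continuousOn
    hω.continuousOn
  refine intervalIntegral.tendsto_integral_filter_of_dominated_convergence (fun s => ‖φ s‖ * b)
    (Eventually.of_forall fun n => ?_) (Eventually.of_forall fun n => ?_) ?_ ?_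
  · refine StronglyMeasurable.aestronglyMeasurable ?_
    have h8 : StronglyMeasurable fun s : ℝ => V (τ n s) ω := by
      exact (hω.measurable.comp (τ n).measurable).stronglyMeasurable
    exact (isBoundedBilinearMap_apply (𝕜 := ℝ)).continuous.comp_stronglyMeasurable
      (hφ.stronglyMeasurable.prodMk h8)
  · refine Eventually.of_forall fun s _ => ((φ s).le_opNorm _).trans ?_
    gcongr
    exact hb _ ⟨zero_le, hτt n s⟩
  · exact (hφ.norm.mul continuous_const).intervalIntegrable _ _
  · refine Eventually.of_forall fun s hs => ?_
    rw [Set.uIoc_of_le t.coe_nonneg] at hs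
    exact (((φ s).continuous.comp hω).tendsto _).comp (hτ s hs.2)

/-- The uncontrolled Ornstein-Uhlenbeck process exists, by variation of constants. -/
theorem exists_isOUProcess [CompleteSpace X] [FiniteDimensional ℝ X] (hW : IsWiener μ F W)
    (hξ : AEStronglyMeasurable[F 0] ξ μ) (M : X →L[ℝ] X) :
    ∃ Z : ℝ≥0 → Ω → X, IsOUProcess μ F M B K W ξ 0 Z := by
  let h : Ω → ℝ → X := fun ω t => K (W t.toNNReal ω)
  have hh : ∀ᵐ ω ∂μ, Continuous (h ω) := by
    filter_upwards [hW.ae_continuous] with ω hω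
    exact K.continuous.comp (hω.comp continuous_real_toNNReal)
  refine ⟨fun t ω => vocSolution M (ξ ω) (h ω) t + K (W t ω), fun t => ?_, ?_, ?_⟩
  · obtain ⟨ξ', hξ'm, hξ'⟩ := hξ
    have hφ : Continuous fun s : ℝ => NormedSpace.exp ((-s) • M) ∘L M ∘L K :=
      ((continuous_exp_smul M).comp continuous_neg).clm_comp continuous_const
    obtain ⟨I, hIm, hI⟩ := aestronglyMeasurable_integral_of_past (m := F t) t
      (fun s hs => (hW.adapted s).mono (F.mono hs)) hW.ae_continuous hφ
    refine ⟨fun ω => NormedSpace.exp ((t : ℝ) • M) (ξ' ω + I ω) + K (W t ω), ?_, ?_⟩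
    · exact ((NormedSpace.exp ((t : ℝ) • M)).continuous.comp_stronglyMeasurable
        ((hξ'm.mono (F.mono zero_le)).add hIm)).add
          (K.continuous.comp_stronglyMeasurable (hW.adapted t))
    · filter_upwards [hξ', hI] with ω h1 h2
      rw [← h1, ← h2]
      rfl
  · filter_upwards [hh, hW.ae_continuous] with ω h1 h2
    exact ((continuous_vocSolution M (ξ ω) h1).comp NNReal.continuous_coe).add
      (K.continuous.comp h2)
  · filter_upwards [hh] with ω h1 t
    rw [vocSolution_eq_integral M (ξ ω) h1]
    congr 2
    refine intervalIntegral.integral_congr fun s hs => ?_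
    rw [Set.uIcc_of_le t.coe_nonneg] at hs
    simp only [Pi.zero_apply, map_zero, add_zero, h, Real.coe_toNNReal s hs.1]

variable {A : X →L[ℝ] X} {R : U →L[ℝ] U} {P : X →L[ℝ] X} {Z : ℝ≥0 → Ω → X}

/-- The process controlled by its own feedback is the uncontrolled process of the closed loop. -/
lemma isOUProcess_feedback_iff [CompleteSpace X] [CompleteSpace U] :
    IsOUProcess μ F A B K W ξ (feedback B R P Z) Z ↔
      IsOUProcess μ F (A - controlOp B R * P) B K W ξ 0 Z := by
  have h : ∀ (t : ℝ≥0) ω, A (Z t ω) + B (feedback B R P Z t ω)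
      = (A - controlOp B R * P) (Z t ω) + B ((0 : ℝ≥0 → Ω → U) t ω) := by
    intro t ω
    rw [← comp_gain]
    simp [feedback, sub_eq_add_neg]
  constructor
  · exact fun hZ => ⟨hZ.adapted, hZ.continuous, by simpa only [h] using hZ.equation⟩
  · exact fun hZ => ⟨hZ.adapted, hZ.continuous, by simpa only [h] using hZ.equation⟩

variable {u : ℝ≥0 → Ω → U} [IsProbabilityMeasure μ] [CompleteSpace X]

/-- The process itself satisfies the conditions on controls, so it can serve as a control. -/
lemma IsOUProcess.isAdmissible (hW : IsWiener μ F W) (hξ2 : MemLp ξ 2 μ)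
    (hu : IsAdmissible μ F u) (hZ : IsOUProcess μ F A B K W ξ u Z) : IsAdmissible μ F Z :=
  .of_memLp (aestronglyMeasurable_uncurried (fun t => hZ.adapted.aestronglyMeasurable t)
    hZ.continuous _) hZ.adapted (hZ.memLp_uncurried hW hξ2 hu)

end Existence

/-! ### Second moment bounds -/

section QuadraticFunctionals

variable {Ω : Type*} [mΩ : MeasurableSpace Ω] {μ : Measure Ω} [IsProbabilityMeasure μ]
  {X : Type*} [NormedAddCommGroup X] [InnerProductSpace ℝ X]

lemma integral_inner_nonneg {α : Type*} [MeasurableSpace α] {ν : Measure α} {M : X →L[ℝ] X}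
    (hM : M.IsPositive) (g : α → X) : 0 ≤ ∫ a, inner ℝ (M (g a)) (g a) ∂ν :=
  integral_nonneg fun a => hM.inner_nonneg_left (g a)

/-- A Fubini formula for quadratic functionals of a square integrable process. -/
lemma integral_timeProd_inner {Z : ℝ≥0 → Ω → X} {T : ℝ} (hZ : MemLp (uncurried Z) 2 (timeProd μ T))
    (P : X →L[ℝ] X) :
    ∫ p, inner ℝ (P (uncurried Z p)) (uncurried Z p) ∂timeProd μ T
      = ∫ t in Set.Ioo 0 T, ∫ ω, inner ℝ (P (Z t.toNNReal ω)) (Z t.toNNReal ω) ∂μ :=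
  integral_prod _ (integrable_inner (P.comp_memLp' hZ) hZ)

end QuadraticFunctionals

section SecondMoments

variable {Ω : Type*} [mΩ : MeasurableSpace Ω] {μ : Measure Ω} [IsProbabilityMeasure μ] {d : ℕ}
  {F : Filtration ℝ≥0 mΩ} {W : ℝ≥0 → Ω → EuclideanSpace ℝ (Fin d)}
  {X U : Type*} [NormedAddCommGroup X] [InnerProductSpace ℝ X] [CompleteSpace X]
  [FiniteDimensional ℝ X] [NormedAddCommGroup U] [InnerProductSpace ℝ U]
  {A : X →L[ℝ] X} {B : U →L[ℝ] X} {K : EuclideanSpace ℝ (Fin d) →L[ℝ] X} {ξ : Ω → X}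
  {u : ℝ≥0 → Ω → U} {Z : ℝ≥0 → Ω → X}

/-- The energy identity along a controlled Ornstein-Uhlenbeck process. -/
lemma IsOUProcess.energy_identity (hW : IsWiener μ F W) (hξ : AEStronglyMeasurable[F 0] ξ μ)
    (hξ2 : MemLp ξ 2 μ) (hu : IsAdmissible μ F u) (hZ : IsOUProcess μ F A B K W ξ u Z)
    {P : X →L[ℝ] X} (hP : IsSelfAdjoint P) (T : ℝ≥0) :
    ∫ ω, inner ℝ (P (Z T ω)) (Z T ω) ∂μ = ∫ ω, inner ℝ (P (ξ ω)) (ξ ω) ∂μ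
      + ∫ p, 2 * inner ℝ (P (uncurried Z p)) (A (uncurried Z p) + B (uncurried u p)) ∂timeProd μ T
      + noiseTrace K P * T :=
  OULQR.energy_identity hW hξ hξ2
    (((hZ.isAdmissible hW hξ2 hu).clm_comp A).add (hu.clm_comp B)) hZ.equation
    (hZ.memLp_uncurried hW hξ2 hu) hP T

/-- The Lyapunov function of a strictly dissipative drift controls the second moments of the
process by those of the control. -/
lemma IsOUProcess.second_moment_le (hW : IsWiener μ F W) (hξ : AEStronglyMeasurable[F 0] ξ μ)
    (hξ2 : MemLp ξ 2 μ) (hu : IsAdmissible μ F u) (hZ : IsOUProcess μ F A B K W ξ u Z)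
    {M : X →L[ℝ] X} (hM : IsSelfAdjoint M) {κ : ℝ} (hκ : 0 < κ)
    (hMA : ∀ x, 2 * inner ℝ (M x) (A x) ≤ -κ * ‖x‖ ^ 2) (T : ℝ≥0) :
    κ / 2 * (∫ p, ‖uncurried Z p‖ ^ 2 ∂timeProd μ T) + ∫ ω, inner ℝ (M (Z T ω)) (Z T ω) ∂μ
      ≤ ∫ ω, inner ℝ (M (ξ ω)) (ξ ω) ∂μ + noiseTrace K M * T
        + 2 / κ * (‖M‖ * ‖B‖) ^ 2 * ∫ p, ‖uncurried u p‖ ^ 2 ∂timeProd μ T := by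
  have hZ2 := hZ.memLp_uncurried hW hξ2 hu T
  have hu2 := hu.memLp T
  have hpt : ∀ x w, 2 * inner ℝ (M x) (A x + B w)
      ≤ 2 / κ * (‖M‖ * ‖B‖) ^ 2 * ‖w‖ ^ 2 - κ / 2 * ‖x‖ ^ 2 := by
    intro x w
    have h1 : inner ℝ (M x) (B w) ≤ (‖M‖ * ‖x‖) * (‖B‖ * ‖w‖) :=
      (real_inner_le_norm _ _).trans
        (mul_le_mul (M.le_opNorm x) (B.le_opNorm w) (norm_nonneg _) (by positivity))
    -- Young's inequality, splitting off half of the dissipation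
    have h2 : 0 ≤ κ / 2 * (‖x‖ - 2 / κ * (‖M‖ * ‖B‖) * ‖w‖) ^ 2 := by positivity
    have h3 : κ / 2 * (‖x‖ - 2 / κ * (‖M‖ * ‖B‖) * ‖w‖) ^ 2 = κ / 2 * ‖x‖ ^ 2
        - 2 * ((‖M‖ * ‖x‖) * (‖B‖ * ‖w‖)) + 2 / κ * (‖M‖ * ‖B‖) ^ 2 * ‖w‖ ^ 2 := by
      field_simp
      ring
    rw [inner_add_right]
    linarith [hMA x]
  rw [hZ.energy_identity hW hξ hξ2 hu hM T]
  have h4 : ∫ p, 2 * inner ℝ (M (uncurried Z p)) (A (uncurried Z p) + B (uncurried u p))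
        ∂timeProd μ T
      ≤ ∫ p, (2 / κ * (‖M‖ * ‖B‖) ^ 2 * ‖uncurried u p‖ ^ 2 - κ / 2 * ‖uncurried Z p‖ ^ 2)
        ∂timeProd μ T := by
    refine integral_mono ((integrable_inner (M.comp_memLp' hZ2)
      ((A.comp_memLp' hZ2).add (B.comp_memLp' hu2))).const_mul 2)
      ((hu2.norm.integrable_sq.const_mul _).sub (hZ2.norm.integrable_sq.const_mul _))
      fun p => hpt _ _
  rw [integral_sub (hu2.norm.integrable_sq.const_mul _)
    (hZ2.norm.integrable_sq.const_mul _)] at h4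
  simp only [integral_const_mul] at h4 ⊢
  linarith

/-- The energy of uncontrolled processes grows at most linearly in time, also near `0`, with a
constant that depends on the drift only through the rate of dissipation `κ`. -/
lemma exists_second_moment_le_mul (hW : IsWiener μ F W) (hξ : AEStronglyMeasurable[F 0] ξ μ)
    (hξ2 : MemLp ξ 2 μ) (K : EuclideanSpace ℝ (Fin d) →L[ℝ] X) {M : X →L[ℝ] X}
    (hM : IsPosDefOp M) {κ : ℝ} (hκ : 0 < κ) :
    ∃ c : ℝ, 0 ≤ c ∧ ∀ (A : X →L[ℝ] X) (Z : ℝ≥0 → Ω → X),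
      (∀ x, 2 * inner ℝ (M x) (A x) ≤ -κ * ‖x‖ ^ 2) →
      IsOUProcess μ F A B K W ξ 0 Z → ∀ T : ℝ≥0,
        ∫ p, ‖uncurried Z p‖ ^ 2 ∂timeProd μ T ≤ c * T := by
  obtain ⟨m, hm, hMm⟩ := hM.exists_coercive
  set e := ∫ ω, inner ℝ (M (ξ ω)) (ξ ω) ∂μ with he
  set τ := noiseTrace K M with hτ
  have he0 : 0 ≤ e := integral_inner_nonneg hM.isPositive ξ
  have hb0 : 0 ≤ e + |τ| := by positivity
  refine ⟨(e + |τ|) * (2 / κ + 1 / m), by positivity, fun A Z hMA hZ T => ?_⟩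
  have hle : ∀ t : ℝ≥0, κ / 2 * (∫ p, ‖uncurried Z p‖ ^ 2 ∂timeProd μ t)
      + ∫ ω, inner ℝ (M (Z t ω)) (Z t ω) ∂μ ≤ e + |τ| * t := by
    intro t
    have h1 := hZ.second_moment_le hW hξ hξ2 isAdmissible_zero hM.1 hκ hMA t
    have h2 : τ * t ≤ |τ| * t := by gcongr; exact le_abs_self τ
    have h3 : ∀ p, uncurried (0 : ℝ≥0 → Ω → U) p = 0 := fun _ => rfl
    simp only [h3, integral_zero, norm_zero, mul_zero, ne_eq, OfNat.ofNat_ne_zero,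
      not_false_eq_true, zero_pow, add_zero] at h1
    linarith
  have hZ2 := hZ.memLp_uncurried hW hξ2 isAdmissible_zero
  have hI0 : 0 ≤ ∫ p, ‖uncurried Z p‖ ^ 2 ∂timeProd μ T := integral_nonneg fun _ => sq_nonneg _
  rcases le_total T 1 with hT | hT
  · -- for short times the bound comes from the marginals, for long ones from the dissipation
    have hmarg : ∀ t : ℝ≥0, t ≤ 1 → ∫ ω, ‖Z t ω‖ ^ 2 ∂μ ≤ (e + |τ|) * (1 / m) := by
      intro t ht
      have hZt := hZ.memLp hW hξ2 isAdmissible_zero t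
      have h3 : m * ∫ ω, ‖Z t ω‖ ^ 2 ∂μ ≤ ∫ ω, inner ℝ (M (Z t ω)) (Z t ω) ∂μ := by
        rw [← integral_const_mul]
        exact integral_mono (hZt.norm.integrable_sq.const_mul _)
          (integrable_inner (M.comp_memLp' hZt) hZt) fun ω => hMm _
      have h4 : 0 ≤ ∫ p, ‖uncurried Z p‖ ^ 2 ∂timeProd μ t := integral_nonneg fun _ => sq_nonneg _
      have h5 : |τ| * t ≤ |τ| * 1 := by gcongr; exact_mod_cast ht
      have h6 := hle t
      rw [mul_one_div, le_div_iff₀ hm]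
      nlinarith
    have h7 : ∫ p, ‖uncurried Z p‖ ^ 2 ∂timeProd μ T
        = ∫ t in Set.Ioo 0 (T : ℝ), ∫ ω, ‖Z t.toNNReal ω‖ ^ 2 ∂μ :=
      integral_prod _ (hZ2 T).norm.integrable_sq
    rw [h7]
    calc ∫ t in Set.Ioo 0 (T : ℝ), ∫ ω, ‖Z t.toNNReal ω‖ ^ 2 ∂μ
        ≤ ∫ t in Set.Ioo 0 (T : ℝ), (e + |τ|) * (1 / m) := by
          refine setIntegral_mono_on (hZ2 T).norm.integrable_sq.integral_prod_left
            (integrable_const _) measurableSet_Ioo fun t ht => hmarg _ ?_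
          exact Real.toNNReal_le_one.2 (ht.2.le.trans (by exact_mod_cast hT))
      _ = (e + |τ|) * (1 / m) * T := by
          simp [Real.volume_real_Ioo_of_le T.coe_nonneg, mul_comm]
      _ ≤ (e + |τ|) * (2 / κ + 1 / m) * T := by
          gcongr
          have : 0 < 2 / κ := by positivity
          linarith
  · have hT' : (1 : ℝ) ≤ T := by exact_mod_cast hT
    have h1 := hle T
    have h2 := integral_inner_nonneg (ν := μ) hM.isPositive (Z T)
    have h3 : ∫ p, ‖uncurried Z p‖ ^ 2 ∂timeProd μ T ≤ (e + |τ|) * (2 / κ) * T := by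
      have : κ / 2 * (∫ p, ‖uncurried Z p‖ ^ 2 ∂timeProd μ T) ≤ (e + |τ|) * T := by nlinarith
      calc ∫ p, ‖uncurried Z p‖ ^ 2 ∂timeProd μ T
          = 2 / κ * (κ / 2 * (∫ p, ‖uncurried Z p‖ ^ 2 ∂timeProd μ T)) := by field_simp
        _ ≤ 2 / κ * ((e + |τ|) * T) := by gcongr
        _ = _ := by ring
    refine h3.trans ?_
    gcongr
    have : 0 < 1 / m := by positivity
    linarith

end SecondMoments

/-! ### Stability of the feedback control under perturbations -/

section FeedbackError

variable {Ω : Type*} [mΩ : MeasurableSpace Ω] {μ : Measure Ω} {d : ℕ}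
  {F : Filtration ℝ≥0 mΩ} {W : ℝ≥0 → Ω → EuclideanSpace ℝ (Fin d)}
  {X U : Type*} [NormedAddCommGroup X] [InnerProductSpace ℝ X]
  [NormedAddCommGroup U] [InnerProductSpace ℝ U]
  {A₁ A₂ : X →L[ℝ] X} {B : U →L[ℝ] X} {K : EuclideanSpace ℝ (Fin d) →L[ℝ] X} {ξ : Ω → X}
  {Z₁ Z₂ : ℝ≥0 → Ω → X}

/-- The difference of two processes driven by the same noise is a noiseless process, controlled
by the second one through the difference of the drifts. -/
lemma IsOUProcess.sub (h₁ : IsOUProcess μ F A₁ B K W ξ 0 Z₁)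
    (h₂ : IsOUProcess μ F A₂ B K W ξ 0 Z₂) :
    IsOUProcess μ F A₁ (A₂ - A₁) (0 : EuclideanSpace ℝ (Fin d) →L[ℝ] X) W 0 Z₂
      (fun t ω => Z₂ t ω - Z₁ t ω) where
  adapted := by
    have h := h₂.adapted.add (h₁.adapted.clm_comp (-ContinuousLinearMap.id ℝ X))
    simpa [sub_eq_add_neg] using h
  continuous := by
    filter_upwards [h₁.continuous, h₂.continuous] with ω c₁ c₂ using c₂.sub c₁
  equation := by
    filter_upwards [h₁.continuous, h₂.continuous, h₁.equation, h₂.equation]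
      with ω c₁ c₂ e₁ e₂ t
    have i₁ : Continuous fun s : ℝ => A₁ (Z₁ s.toNNReal ω) :=
      A₁.continuous.comp (c₁.comp continuous_real_toNNReal)
    have i₂ : Continuous fun s : ℝ => A₂ (Z₂ s.toNNReal ω) :=
      A₂.continuous.comp (c₂.comp continuous_real_toNNReal)
    simp only [Pi.zero_apply, map_zero, add_zero] at e₁ e₂
    have h : ∀ s : ℝ, A₁ (Z₂ s.toNNReal ω - Z₁ s.toNNReal ω) + (A₂ - A₁) (Z₂ s.toNNReal ω)
        = A₂ (Z₂ s.toNNReal ω) - A₁ (Z₁ s.toNNReal ω) := by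
      intro s
      simp
    simp only [h]
    rw [intervalIntegral.integral_sub (i₂.intervalIntegrable _ _) (i₁.intervalIntegrable _ _),
      e₁, e₂]
    simp

variable [IsProbabilityMeasure μ] [CompleteSpace X] [FiniteDimensional ℝ X] [CompleteSpace U]
  {A : X →L[ℝ] X}

/-- Perturbing the feedback operator `P` of a stable closed loop perturbs the feedback control by at
most a multiple of the perturbation, in the mean over `(0, T)` and uniformly in `T`. -/
theorem exists_normOmegaT_feedback_sub_le (hW : IsWiener μ F W)
    (hξ : AEStronglyMeasurable[F 0] ξ μ) (hξ2 : MemLp ξ 2 μ) {R : U →L[ℝ] U} {P : X →L[ℝ] X}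
    (hP : IsExpStable (A - controlOp B R * P)) :
    ∃ δ c : ℝ, 0 < δ ∧ 0 ≤ c ∧ ∀ Q : X →L[ℝ] X, ‖P - Q‖ ≤ δ → ∀ Z Y : ℝ≥0 → Ω → X,
      IsOUProcess μ F A B K W ξ (feedback B R P Z) Z →
      IsOUProcess μ F A B K W ξ (feedback B R Q Y) Y → ∀ T : ℝ, 0 < T →
        ENNReal.ofReal (T ^ (-1 / 2 : ℝ)) *
          normOmegaT μ T (fun t ω => feedback B R P Z t ω - feedback B R Q Y t ω)
          ≤ ENNReal.ofReal (c * ‖P - Q‖) := by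
  obtain ⟨M, hM, hMP⟩ := hP.exists_lyapunov_function
  set S := controlOp B R with hS
  set G : X →L[ℝ] U := Ring.inverse R ∘L ContinuousLinearMap.adjoint B with hG
  obtain ⟨c₀, hc₀, hY⟩ := exists_second_moment_le_mul (B := B) hW hξ hξ2 K hM one_half_pos
  have hdiss : ∀ x, 2 * inner ℝ (M x) ((A - S * P) x) = -‖x‖ ^ 2 := by
    intro x
    rw [← inner_lyapunov _ _ hM.1, hMP]
    simp
  set Γ := (8 * ‖gain B R P‖ ^ 2 * (‖M‖ * ‖S‖) ^ 2 + 2 * ‖G‖ ^ 2) * c₀ with hΓ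
  -- within this distance `M` is still a Lyapunov function, at half the rate
  refine ⟨1 / (4 * (‖M‖ * ‖S‖ + 1)), √Γ, by positivity, by positivity,
    fun Q hQ Z Y hZ hYQ T hT => ?_⟩
  lift T to ℝ≥0 using hT.le
  rw [isOUProcess_feedback_iff] at hZ hYQ
  set D := ‖P - Q‖ with hD
  have hdrift : (A - S * Q) - (A - S * P) = S * (P - Q) := by
    rw [mul_sub]; abel
  have hSD : ‖(A - S * Q) - (A - S * P)‖ ≤ ‖S‖ * D := hdrift ▸ norm_mul_le _ _
  have hdissQ : ∀ x, 2 * inner ℝ (M x) ((A - S * Q) x) ≤ -(1 / 2) * ‖x‖ ^ 2 := by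
    intro x
    have h1 : (A - S * Q) x = (A - S * P) x + ((A - S * Q) - (A - S * P)) x := by simp
    have h2 : inner ℝ (M x) (((A - S * Q) - (A - S * P)) x)
        ≤ (‖M‖ * ‖x‖) * (‖S‖ * D * ‖x‖) :=
      (real_inner_le_norm _ _).trans (mul_le_mul (M.le_opNorm x)
        (ContinuousLinearMap.le_of_opNorm_le _ hSD x) (norm_nonneg _) (by positivity))
    have h3 : ‖M‖ * ‖S‖ * D ≤ 1 / 4 := by
      rw [le_div_iff₀ (by positivity)] at hQ
      nlinarith [norm_nonneg (P - Q)]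
    rw [h1, inner_add_right, mul_add, hdiss]
    nlinarith [mul_le_mul_of_nonneg_right h3 (sq_nonneg ‖x‖)]
  have hYa := hYQ.isAdmissible hW hξ2 isAdmissible_zero
  have hE := hZ.sub hYQ
  set E : ℝ≥0 → Ω → X := fun t ω => Y t ω - Z t ω with hEdef
  have hY1 := hY _ Y hdissQ hYQ T
  have hE1 := hE.second_moment_le hW aestronglyMeasurable_const (memLp_const 0) hYa hM.1
    one_pos (fun x => by rw [hdiss, neg_one_mul]) T
  have hE2 := integral_inner_nonneg (ν := μ) hM.isPositive (E T)
  have hY2 := hYa.memLp T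
  have hE3 := hE.memLp_uncurried hW (memLp_const 0) hYa T
  set IY := ∫ p, ‖uncurried Y p‖ ^ 2 ∂timeProd μ T
  set IE := ∫ p, ‖uncurried E p‖ ^ 2 ∂timeProd μ T
  have hIY : 0 ≤ IY := integral_nonneg fun _ => sq_nonneg _
  have hIE : IE ≤ 4 * (‖M‖ * (‖S‖ * D)) ^ 2 * IY := by
    have h1 : 2 / 1 * (‖M‖ * ‖(A - S * Q) - (A - S * P)‖) ^ 2 * IY
        ≤ 2 / 1 * (‖M‖ * (‖S‖ * D)) ^ 2 * IY := by gcongr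
    simp only [map_zero, inner_zero_right, integral_zero, noiseTrace, zero_apply,
      Finset.sum_const_zero, zero_mul, add_zero, zero_add] at hE1
    linarith
  set f : ℝ≥0 → Ω → U := fun t ω => feedback B R P Z t ω - feedback B R Q Y t ω with hf
  have hfeq : uncurried f
      = fun p => gain B R P (uncurried E p) + (gain B R Q - gain B R P) (uncurried Y p) := by
    ext1 p
    simp only [uncurried, hf, hEdef, feedback, map_sub, sub_apply]
    abel
  have hf2 : MemLp (uncurried f) 2 (timeProd μ T) := by
    rw [hfeq]
    exact ((gain B R P).comp_memLp' hE3).add ((gain B R Q - gain B R P).comp_memLp' hY2)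
  have hgain : ‖gain B R Q - gain B R P‖ ≤ ‖G‖ * D := by
    have h1 : gain B R Q - gain B R P = G ∘L (Q - P) := by
      ext x
      simp [gain, hG]
    rw [h1, hD, norm_sub_rev P Q]
    exact ContinuousLinearMap.opNorm_comp_le _ _
  have hIf : ∫ p, ‖uncurried f p‖ ^ 2 ∂timeProd μ T ≤ Γ * D ^ 2 * T := by
    calc ∫ p, ‖uncurried f p‖ ^ 2 ∂timeProd μ T
        ≤ ∫ p, (2 * ‖gain B R P‖ ^ 2 * ‖uncurried E p‖ ^ 2
            + 2 * (‖G‖ * D) ^ 2 * ‖uncurried Y p‖ ^ 2) ∂timeProd μ T := by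
          refine integral_mono hf2.norm.integrable_sq ((hE3.norm.integrable_sq.const_mul _).add
            (hY2.norm.integrable_sq.const_mul _)) fun p => ?_
          rw [hfeq]
          have h1 := (gain B R P).le_opNorm (uncurried E p)
          have h2 := ContinuousLinearMap.le_of_opNorm_le _ hgain (uncurried Y p)
          calc ‖gain B R P (uncurried E p) + (gain B R Q - gain B R P) (uncurried Y p)‖ ^ 2
              ≤ (‖gain B R P‖ * ‖uncurried E p‖ + ‖G‖ * D * ‖uncurried Y p‖) ^ 2 := by
                gcongr
                exact (norm_add_le _ _).trans (add_le_add h1 h2)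
            _ ≤ _ := by
                nlinarith [sq_nonneg (‖gain B R P‖ * ‖uncurried E p‖ - ‖G‖ * D * ‖uncurried Y p‖)]
      _ = 2 * ‖gain B R P‖ ^ 2 * IE + 2 * (‖G‖ * D) ^ 2 * IY := by
          rw [integral_add (hE3.norm.integrable_sq.const_mul _)
            (hY2.norm.integrable_sq.const_mul _), integral_const_mul, integral_const_mul]
      _ ≤ 2 * ‖gain B R P‖ ^ 2 * (4 * (‖M‖ * (‖S‖ * D)) ^ 2 * IY) + 2 * (‖G‖ * D) ^ 2 * IY := by
          gcongr
      _ = (8 * ‖gain B R P‖ ^ 2 * (‖M‖ * ‖S‖) ^ 2 + 2 * ‖G‖ ^ 2) * D ^ 2 * IY := by ring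
      _ ≤ (8 * ‖gain B R P‖ ^ 2 * (‖M‖ * ‖S‖) ^ 2 + 2 * ‖G‖ ^ 2) * D ^ 2 * (c₀ * T) := by gcongr
      _ = Γ * D ^ 2 * T := by rw [hΓ]; ring
  have hnorm : normOmegaT μ T f ≤ ENNReal.ofReal (√Γ * D * √T) := by
    rw [normOmegaT, sqNormOmegaT_eq_ofReal hf2]
    calc ENNReal.ofReal (∫ p, ‖uncurried f p‖ ^ 2 ∂timeProd μ T) ^ (1 / 2 : ℝ)
        ≤ ENNReal.ofReal (Γ * D ^ 2 * T) ^ (1 / 2 : ℝ) := by gcongr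
      _ = ENNReal.ofReal (√Γ * D * √T) := by
          rw [ENNReal.ofReal_rpow_of_nonneg (by positivity) (by norm_num), ← Real.sqrt_eq_rpow,
            Real.sqrt_mul (by positivity), Real.sqrt_mul (by positivity),
            Real.sqrt_sq (norm_nonneg _)]
  calc _ ≤ ENNReal.ofReal ((T : ℝ) ^ (-1 / 2 : ℝ)) * ENNReal.ofReal (√Γ * D * √T) := by gcongr
    _ = ENNReal.ofReal (√Γ * D) := by
        rw [← ENNReal.ofReal_mul (by positivity)]
        congr 1
        have h1 : (T : ℝ) ^ (-1 / 2 : ℝ) = (√T)⁻¹ := by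
          rw [neg_div, Real.rpow_neg hT.le, Real.sqrt_eq_rpow]
        have h2 : √(T : ℝ) ≠ 0 := (Real.sqrt_pos.2 hT).ne'
        rw [h1]
        field_simp

end FeedbackError

/-! ### The running cost -/

section RunningCost

variable {Ω : Type*} [MeasurableSpace Ω] {μ : Measure Ω}
  {X H U : Type*} [NormedAddCommGroup X] [InnerProductSpace ℝ X]
  [NormedAddCommGroup H] [InnerProductSpace ℝ H] [NormedAddCommGroup U] [InnerProductSpace ℝ U]
  {A : X →L[ℝ] X} {B : U →L[ℝ] X} {C : X →L[ℝ] H} {R : U →L[ℝ] U} {P : X →L[ℝ] X}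
  {u : ℝ≥0 → Ω → U} {Z : ℝ≥0 → Ω → X}

lemma integrable_runningCost {T : ℝ} (hZ : MemLp (uncurried Z) 2 (timeProd μ T))
    (hu : MemLp (uncurried u) 2 (timeProd μ T)) : Integrable (fun p =>
      ‖C (uncurried Z p)‖ ^ 2 + inner ℝ (uncurried u p) (R (uncurried u p))) (timeProd μ T) :=
  (C.comp_memLp' hZ).norm.integrable_sq.add (integrable_inner hu (R.comp_memLp' hu))

/-- The integral over `Ω × (0, T)` of the running cost. -/
noncomputable def costIntegral (μ : Measure Ω) (C : X →L[ℝ] H) (R : U →L[ℝ] U)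
    (Z : ℝ≥0 → Ω → X) (u : ℝ≥0 → Ω → U) (T : ℝ) : ℝ :=
  ∫ p, (‖C (uncurried Z p)‖ ^ 2 + inner ℝ (uncurried u p) (R (uncurried u p))) ∂timeProd μ T

lemma cost_eq_ofReal [IsProbabilityMeasure μ] [CompleteSpace U] (hR : IsPosDefOp R) {T : ℝ}
    (hT : 0 < T) (hZ : MemLp (uncurried Z) 2 (timeProd μ T))
    (hu : MemLp (uncurried u) 2 (timeProd μ T)) :
    cost μ C R Z u T = ENNReal.ofReal (costIntegral μ C R Z u T / T) := by
  have hCZ : MemLp (uncurried fun t ω => C (Z t ω)) 2 (timeProd μ T) := C.comp_memLp' hZ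
  have hRu : Integrable (fun p => inner ℝ (uncurried u p) (R (uncurried u p))) (timeProd μ T) :=
    integrable_inner hu (R.comp_memLp' hu)
  have hR0 : ∀ w, 0 ≤ inner ℝ w (R w) := hR.isPositive.inner_nonneg_right
  have h1 : ∫⁻ ω, ∫⁻ t in Set.Ioo (0 : ℝ) T,
      ENNReal.ofReal (inner ℝ (u t.toNNReal ω) (R (u t.toNNReal ω))) ∂volume ∂μ
      = ENNReal.ofReal (∫ p, inner ℝ (uncurried u p) (R (uncurried u p)) ∂timeProd μ T) := by
    rw [ofReal_integral_eq_lintegral_ofReal hRu (Eventually.of_forall fun _ => hR0 _),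
      lintegral_prod_symm _ hRu.1.aemeasurable.ennreal_ofReal]
    rfl
  rw [cost, sqNormOmegaT_eq_ofReal hCZ, h1, ← ENNReal.ofReal_add
    (integral_nonneg fun _ => sq_nonneg _) (integral_nonneg fun _ => hR0 _),
    ← ENNReal.ofReal_inv_of_pos hT, ← ENNReal.ofReal_mul (inv_nonneg.2 hT.le),
    ← integral_add hCZ.norm.integrable_sq hRu, inv_mul_eq_div]
  rfl

variable [CompleteSpace X] [CompleteSpace H] [CompleteSpace U] [FiniteDimensional ℝ U]

/-- Completion of the square in the running cost. -/
lemma RiccatiEq.completion_of_square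
    (h : RiccatiEq A (controlOp B R) (ContinuousLinearMap.adjoint C ∘L C) P)
    (hR : IsPosDefOp R) (hP : IsSelfAdjoint P) (x : X) (w : U) :
    ‖C x‖ ^ 2 + inner ℝ w (R w) + 2 * inner ℝ (P x) (A x + B w)
      = inner ℝ (w + gain B R P x) (R (w + gain B R P x)) := by
  have h1 : R (gain B R P x) = ContinuousLinearMap.adjoint B (P x) := hR.apply_inverse _
  have h2 : inner ℝ x ((star A * P + P * A + ContinuousLinearMap.adjoint C ∘L C
      - P * controlOp B R * P) x) = 0 := by
    rw [show _ = _ from h]; simp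
  have h3 : inner ℝ (P x) (B w) = inner ℝ w (R (gain B R P x)) := by
    rw [h1, ContinuousLinearMap.adjoint_inner_right, real_inner_comm]
  have h4 : inner ℝ x ((P * controlOp B R * P) x)
      = inner ℝ (gain B R P x) (R (gain B R P x)) := by
    rw [h1, ContinuousLinearMap.adjoint_inner_right, mul_assoc, ← comp_gain]
    simp only [mul_apply_eq_comp, ContinuousLinearMap.comp_apply]
    rw [← hP.inner_apply_comm, real_inner_comm]
  have h5 : inner ℝ x ((star A * P + P * A) x) = 2 * inner ℝ (P x) (A x) := by
    rw [inner_lyapunov _ _ hP]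
  have h6 : inner ℝ x ((ContinuousLinearMap.adjoint C ∘L C) x) = ‖C x‖ ^ 2 := by
    simp [ContinuousLinearMap.adjoint_inner_right]
  have h7 : inner ℝ (gain B R P x) (R w) = inner ℝ w (R (gain B R P x)) := by
    rw [← hR.1.inner_apply_comm, real_inner_comm]
  rw [sub_apply, add_apply, inner_sub_right, inner_add_right, h5, h6, h4] at h2
  rw [map_add, inner_add_left, inner_add_right, inner_add_right, inner_add_right, h7, h3]
  linarith

end RunningCost

/-! ### Optimality of the Riccati feedback -/

section LinearQuadratic

variable {Ω : Type*} [mΩ : MeasurableSpace Ω] {μ : Measure Ω} [IsProbabilityMeasure μ] {d : ℕ}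
  {F : Filtration ℝ≥0 mΩ} {W : ℝ≥0 → Ω → EuclideanSpace ℝ (Fin d)}
  {X H U : Type*} [NormedAddCommGroup X] [InnerProductSpace ℝ X] [CompleteSpace X]
  [FiniteDimensional ℝ X] [NormedAddCommGroup H] [InnerProductSpace ℝ H] [CompleteSpace H]
  [NormedAddCommGroup U] [InnerProductSpace ℝ U] [FiniteDimensional ℝ U] [CompleteSpace U]
  {A : X →L[ℝ] X} {B : U →L[ℝ] X} {C : X →L[ℝ] H} {R : U →L[ℝ] U}
  {K : EuclideanSpace ℝ (Fin d) →L[ℝ] X} {ξ : Ω → X} {P : X →L[ℝ] X}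
  {u : ℝ≥0 → Ω → U} {Z : ℝ≥0 → Ω → X}

/-- The cost in terms of the deviation of the control from the feedback law. -/
lemma costIntegral_add_eq (hW : IsWiener μ F W) (hξ : AEStronglyMeasurable[F 0] ξ μ)
    (hξ2 : MemLp ξ 2 μ) (hu : IsAdmissible μ F u) (hZ : IsOUProcess μ F A B K W ξ u Z)
    (h : RiccatiEq A (controlOp B R) (ContinuousLinearMap.adjoint C ∘L C) P)
    (hR : IsPosDefOp R) (hP : IsSelfAdjoint P) (T : ℝ≥0) :
    costIntegral μ C R Z u T + ∫ ω, inner ℝ (P (Z T ω)) (Z T ω) ∂μ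
      = ∫ ω, inner ℝ (P (ξ ω)) (ξ ω) ∂μ + noiseTrace K P * T
        + ∫ p, inner ℝ (uncurried u p + gain B R P (uncurried Z p))
            (R (uncurried u p + gain B R P (uncurried Z p))) ∂timeProd μ T := by
  have hZ2 := hZ.memLp_uncurried hW hξ2 hu T
  have hu2 := hu.memLp T
  rw [hZ.energy_identity hW hξ hξ2 hu hP T, costIntegral]
  simp only [← h.completion_of_square hR hP]
  have hi : Integrable (fun p =>
      2 * inner ℝ (P (uncurried Z p)) (A (uncurried Z p) + B (uncurried u p))) (timeProd μ T) :=
    (integrable_inner (P.comp_memLp' hZ2)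
      ((A.comp_memLp' hZ2).add (B.comp_memLp' hu2))).const_mul 2
  rw [integral_add (integrable_runningCost hZ2 hu2) hi]
  ring

/-- The Riccati feedback costs at most the trace of `P` against the noise. -/
lemma costInfty_feedback_le (hW : IsWiener μ F W) (hξ : AEStronglyMeasurable[F 0] ξ μ)
    (hξ2 : MemLp ξ 2 μ) (hu : IsAdmissible μ F (feedback B R P Z))
    (hZ : IsOUProcess μ F A B K W ξ (feedback B R P Z) Z)
    (h : RiccatiEq A (controlOp B R) (ContinuousLinearMap.adjoint C ∘L C) P)
    (hR : IsPosDefOp R) (hP : P.IsPositive) :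
    costInfty μ C R Z (feedback B R P Z) ≤ ENNReal.ofReal (noiseTrace K P) := by
  set e := ∫ ω, inner ℝ (P (ξ ω)) (ξ ω) ∂μ
  have h1 : ∀ T : ℝ, 0 < T → cost μ C R Z (feedback B R P Z) T
      ≤ ENNReal.ofReal (e / T + noiseTrace K P) := by
    intro T hT
    rw [cost_eq_ofReal hR hT (hZ.memLp_uncurried hW hξ2 hu T) (hu.memLp T)]
    refine ENNReal.ofReal_le_ofReal ?_
    have h2 := costIntegral_add_eq hW hξ hξ2 hu hZ h hR hP.isSelfAdjoint ⟨T, hT.le⟩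
    have h3 := integral_inner_nonneg (ν := μ) hP (Z ⟨T, hT.le⟩)
    have h4 : ∀ p, uncurried (feedback B R P Z) p + gain B R P (uncurried Z p) = 0 :=
      fun p => neg_add_cancel _
    simp only [h4, inner_zero_left, integral_zero, add_zero] at h2
    change costIntegral μ C R Z (feedback B R P Z) T + _ = e + noiseTrace K P * T at h2
    rw [div_add' _ _ _ hT.ne', div_le_div_iff_of_pos_right hT]
    linarith
  have h5 : Tendsto (fun T : ℝ => ENNReal.ofReal (e / T + noiseTrace K P)) atTop
      (𝓝 (ENNReal.ofReal (noiseTrace K P))) := by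
    refine ENNReal.tendsto_ofReal ?_
    simpa using (tendsto_id.const_div_atTop e).add_const (noiseTrace K P)
  rw [costInfty, ← h5.limsup_eq]
  refine limsup_le_limsup ?_
  filter_upwards [eventually_gt_atTop 0] with T hT using h1 T hT

/-- No admissible control does better than the trace of `P` against the noise: otherwise the energy
of `P` would grow linearly in time, which costs a quadratically growing amount. -/
lemma le_costInfty (hW : IsWiener μ F W) (hξ : AEStronglyMeasurable[F 0] ξ μ)
    (hξ2 : MemLp ξ 2 μ) (hu : IsAdmissible μ F u) (hZ : IsOUProcess μ F A B K W ξ u Z)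
    (hA : IsExpStable A)
    (h : RiccatiEq A (controlOp B R) (ContinuousLinearMap.adjoint C ∘L C) P)
    (hR : IsPosDefOp R) (hP : P.IsPositive) :
    ENNReal.ofReal (noiseTrace K P) ≤ costInfty μ C R Z u := by
  by_contra! hlt
  obtain ⟨b', hb1, hb2⟩ := exists_between hlt
  have hb' : b' ≠ ∞ := (hb2.trans_le le_top).ne
  set b := b'.toReal with hb
  have hbb : b' = ENNReal.ofReal b := (ENNReal.ofReal_toReal hb').symm
  have hb0 : 0 ≤ b := ENNReal.toReal_nonneg
  rw [hbb, ENNReal.ofReal_lt_ofReal_iff_of_nonneg hb0] at hb2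
  set τ := noiseTrace K P
  set ε := τ - b with hε
  have hε0 : 0 < ε := sub_pos.2 hb2
  obtain ⟨r, hr, hRr⟩ := hR.exists_coercive
  obtain ⟨M, hM, hMA⟩ := hA.exists_lyapunov_function
  have hdiss : ∀ x, 2 * inner ℝ (M x) (A x) ≤ -1 * ‖x‖ ^ 2 := by
    intro x
    rw [← inner_lyapunov _ _ hM.1, hMA]
    simp
  have hZ2 := hZ.memLp_uncurried hW hξ2 hu
  have hev := eventually_lt_of_limsup_lt (hbb ▸ hb1)
  obtain ⟨T₀, hT₀⟩ := eventually_atTop.1 hev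
  -- at times `T ≥ 1` constants are bounded by multiples of `T`
  set T₁ := max T₀ 1 with hT₁
  have hT₁1 : 1 ≤ T₁ := le_max_right _ _
  -- the cost is small at late times
  have hcost : ∀ T : ℝ, T₁ ≤ T → costIntegral μ C R Z u T ≤ b * T := by
    intro T hT
    have hT0 : 0 < T := by linarith
    have h1 := hT₀ T ((le_max_left _ _).trans hT)
    rw [cost_eq_ofReal hR hT0 (hZ2 T) (hu.memLp T)] at h1
    exact ((div_lt_iff₀ hT0).1 (ENNReal.ofReal_lt_ofReal_iff'.1 h1).1).le
  -- so the energy of `P` grows linearly at late times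
  have hgrow : ∀ T : ℝ, T₁ ≤ T →
      ε * T ≤ ∫ ω, inner ℝ (P (Z T.toNNReal ω)) (Z T.toNNReal ω) ∂μ := by
    intro T hT
    have hT0 : 0 ≤ T := by linarith
    have h1 := costIntegral_add_eq hW hξ hξ2 hu hZ h hR hP.isSelfAdjoint T.toNNReal
    have h2 := integral_inner_nonneg (ν := μ) hP ξ
    have h3 : 0 ≤ ∫ p, inner ℝ (uncurried u p + gain B R P (uncurried Z p))
            (R (uncurried u p + gain B R P (uncurried Z p))) ∂timeProd μ T.toNNReal :=
      integral_nonneg fun p => hR.isPositive.inner_nonneg_right _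
    have h4 := hcost T hT
    rw [Real.coe_toNNReal T hT0] at h1 h3
    rw [hε]
    linarith
  -- while the control, and with it the state, is bounded in the mean square
  have hcontrol : ∀ T : ℝ, T₁ ≤ T → ∫ p, ‖uncurried u p‖ ^ 2 ∂timeProd μ T ≤ b / r * T := by
    intro T hT
    have h1 : r * ∫ p, ‖uncurried u p‖ ^ 2 ∂timeProd μ T ≤ costIntegral μ C R Z u T := by
      rw [← integral_const_mul]
      refine integral_mono ((hu.memLp T).norm.integrable_sq.const_mul _)
        (integrable_runningCost (hZ2 T) (hu.memLp T)) fun p => ?_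
      have h2 := hRr (uncurried u p)
      rw [real_inner_comm] at h2
      exact h2.trans (le_add_of_nonneg_left (sq_nonneg _))
    rw [div_mul_eq_mul_div, le_div_iff₀ hr]
    linarith [hcost T hT]
  set e := ∫ ω, inner ℝ (M (ξ ω)) (ξ ω) ∂μ
  set k := 2 * ‖P‖ * (e + |noiseTrace K M| + 2 * (‖M‖ * ‖B‖) ^ 2 * (b / r)) with hk
  have he0 : 0 ≤ e := integral_inner_nonneg hM.isPositive ξ
  have hk0 : 0 ≤ k := by positivity
  have hstate : ∀ T : ℝ, T₁ ≤ T →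
      ∫ p, inner ℝ (P (uncurried Z p)) (uncurried Z p) ∂timeProd μ T ≤ k * T := by
    intro T hT
    have hT0 : 0 ≤ T := by linarith
    have h1 := hZ.second_moment_le hW hξ hξ2 hu hM.1 one_pos hdiss T.toNNReal
    have h2 := integral_inner_nonneg (ν := μ) hM.isPositive (Z T.toNNReal)
    rw [Real.coe_toNNReal T hT0] at h1
    have h3 : noiseTrace K M * T ≤ |noiseTrace K M| * T := by gcongr; exact le_abs_self _
    have h4 : 2 / 1 * (‖M‖ * ‖B‖) ^ 2 * ∫ p, ‖uncurried u p‖ ^ 2 ∂timeProd μ T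
        ≤ 2 / 1 * (‖M‖ * ‖B‖) ^ 2 * (b / r * T) := by gcongr; exact hcontrol T hT
    have h5 : e ≤ e * T := le_mul_of_one_le_right he0 (by linarith)
    have h6 : ∫ p, inner ℝ (P (uncurried Z p)) (uncurried Z p) ∂timeProd μ T
        ≤ ‖P‖ * ∫ p, ‖uncurried Z p‖ ^ 2 ∂timeProd μ T := by
      rw [← integral_const_mul]
      refine integral_mono (integrable_inner (P.comp_memLp' (hZ2 T)) (hZ2 T))
        ((hZ2 T).norm.integrable_sq.const_mul _) fun p => ?_
      refine (real_inner_le_norm _ _).trans ?_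
      rw [pow_two, ← mul_assoc]
      gcongr
      exact P.le_opNorm _
    calc _ ≤ ‖P‖ * ∫ p, ‖uncurried Z p‖ ^ 2 ∂timeProd μ T := h6
      _ ≤ ‖P‖ * (2 * ((e + |noiseTrace K M| + 2 * (‖M‖ * ‖B‖) ^ 2 * (b / r)) * T)) := by
          gcongr
          linarith
      _ = k * T := by rw [hk]; ring
  -- the energy integrated up to `T` is bounded below by a quadratic function of `T`
  have hquad : ∀ T : ℝ, T₁ ≤ T → ε * ((T ^ 2 - T₁ ^ 2) / 2) ≤ k * T := by
    intro T hT
    refine le_trans ?_ (hstate T hT)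
    rw [integral_timeProd_inner (hZ2 T)]
    have hi : IntegrableOn (fun t : ℝ => ∫ ω, inner ℝ (P (Z t.toNNReal ω)) (Z t.toNNReal ω) ∂μ)
        (Set.Ioo 0 T) :=
      (integrable_inner (P.comp_memLp' (hZ2 T)) (hZ2 T)).integral_prod_left
    have hsub : Set.Ioo T₁ T ⊆ Set.Ioo 0 T := Set.Ioo_subset_Ioo_left (by linarith)
    calc ε * ((T ^ 2 - T₁ ^ 2) / 2) = ∫ t in Set.Ioo T₁ T, ε * t := by
          rw [← integral_Ioc_eq_integral_Ioo, ← intervalIntegral.integral_of_le hT,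
            intervalIntegral.integral_const_mul, integral_id]
      _ ≤ ∫ t in Set.Ioo T₁ T, ∫ ω, inner ℝ (P (Z t.toNNReal ω)) (Z t.toNNReal ω) ∂μ := by
          refine setIntegral_mono_on ?_ (hi.mono_set hsub) measurableSet_Ioo
            fun t ht => hgrow t ht.1.le
          exact ((continuous_const.mul continuous_id).integrableOn_Icc).mono_set
            Set.Ioo_subset_Icc_self
      _ ≤ _ := setIntegral_mono_set hi
          (Eventually.of_forall fun t => integral_inner_nonneg hP _) hsub.eventuallyLE
  -- a time at which the quadratic lower bound exceeds the linear upper bound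
  have hfin := hquad (T₁ + 2 * (k + 1) / ε) (by linarith [show 0 ≤ 2 * (k + 1) / ε by positivity])
  set s := 2 * (k + 1) / ε with hs
  have hs0 : 0 < s := by positivity
  have hεs : ε * s = 2 * (k + 1) := by rw [hs]; field_simp
  have h1 : ε * (((T₁ + s) ^ 2 - T₁ ^ 2) / 2) = (k + 1) * (2 * T₁ + s) := by
    rw [show ε * (((T₁ + s) ^ 2 - T₁ ^ 2) / 2) = ε * s * (2 * T₁ + s) / 2 by ring, hεs]
    ring
  rw [h1] at hfin
  nlinarith

/-- The feedback of a positive Riccati solution is optimal. -/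
theorem feedbackIsOptimal (hW : IsWiener μ F W) (hξ : AEStronglyMeasurable[F 0] ξ μ)
    (hξ2 : MemLp ξ 2 μ) (hA : IsExpStable A)
    (h : RiccatiEq A (controlOp B R) (ContinuousLinearMap.adjoint C ∘L C) P)
    (hR : IsPosDefOp R) (hP : P.IsPositive) : FeedbackIsOptimal μ F A B C R K W ξ P := by
  constructor
  · obtain ⟨Z, hZ⟩ := exists_isOUProcess (B := B) (K := K) hW hξ (A - controlOp B R * P)
    exact ⟨Z, isOUProcess_feedback_iff.2 hZ⟩
  · intro Z hZ
    have hZa := (isOUProcess_feedback_iff.1 hZ).isAdmissible hW hξ2 isAdmissible_zero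
    have hu : IsAdmissible μ F (feedback B R P Z) := hZa.clm_comp (-gain B R P)
    exact ⟨hu, fun v Y hv hY => (costInfty_feedback_le hW hξ hξ2 hu hZ h hR hP).trans
      (le_costInfty hW hξ hξ2 hv hY hA h hR hP)⟩

end LinearQuadratic

end OULQR

theorem proposition5p2
    {X H Ω : Type*} {m d : ℕ}
    [NormedAddCommGroup X] [InnerProductSpace ℝ X] [CompleteSpace X] [FiniteDimensional ℝ X]
    [NormedAddCommGroup H] [InnerProductSpace ℝ H] [CompleteSpace H]
    [mΩ : MeasurableSpace Ω] (μ : Measure Ω) [IsProbabilityMeasure μ]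
    (F : Filtration ℝ≥0 mΩ)
    (A : X →L[ℝ] X) (B : EuclideanSpace ℝ (Fin m) →L[ℝ] X) (C : X →L[ℝ] H)
    (K : EuclideanSpace ℝ (Fin d) →L[ℝ] X)
    (R : EuclideanSpace ℝ (Fin m) →L[ℝ] EuclideanSpace ℝ (Fin m))
    (W : ℝ≥0 → Ω → EuclideanSpace ℝ (Fin d)) (ξ : Ω → X)
    (hA : OULQR.IsExpStable A) (hAC : OULQR.IsObservable A C) (hR : OULQR.IsPosDefOp R)
    (hW : OULQR.IsWiener μ F W)
    (hξ : AEStronglyMeasurable[F 0] ξ μ) (hξ2 : MemLp ξ 2 μ) :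
    ∃ (P : X →L[ℝ] X) (Pk : ℕ → X →L[ℝ] X),
      -- `P` is the unique positive-definite solution of the Riccati equation
      (∀ Q : X →L[ℝ] X,
        OULQR.IsPosDefOp Q ∧ OULQR.IsRiccatiSolution A B C R Q ↔ Q = P) ∧
      -- the feedback with `P` solves the infinite-horizon optimal control problem
      OULQR.FeedbackIsOptimal μ F A B C R K W ξ P ∧
      -- `P_k ≥ 0` is the unique solution of the `k`-th Lyapunov equation
      (∀ (k : ℕ) (S : X →L[ℝ] X),
        OULQR.IsLyapunovSolution A B C R (OULQR.iterGain B R Pk k) S ↔ S = Pk k) ∧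
      (∀ k, (Pk k).IsPositive) ∧
      -- monotone and quadratic convergence to `P`
      (∀ k, (Pk k - Pk (k + 1)).IsPositive ∧ (Pk k - P).IsPositive) ∧
      Tendsto Pk atTop (𝓝 P) ∧
      (∃ c : ℝ, ∀ k, ‖Pk (k + 1) - P‖ ≤ c * ‖Pk k - P‖ ^ 2 ∧
        ‖Pk (k + 1) - P‖ ≤ c * ‖Pk (k + 1) - Pk k‖ ^ 2) ∧
      -- the feedback with each `P_k` is well defined
      (∀ k, ∃ Z : ℝ≥0 → Ω → X,
        OULQR.IsOUProcess μ F A B K W ξ (OULQR.feedback B R (Pk k) Z) Z) ∧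
      -- error of the feedback controls, uniformly in `T`
      (∃ δ c : ℝ, 0 < δ ∧ ∀ k : ℕ, ‖P - Pk (k + 1)‖ ≤ δ →
        ∀ Z Zk : ℝ≥0 → Ω → X,
          OULQR.IsOUProcess μ F A B K W ξ (OULQR.feedback B R P Z) Z →
          OULQR.IsOUProcess μ F A B K W ξ (OULQR.feedback B R (Pk (k + 1)) Zk) Zk →
          ∀ T : ℝ, 0 < T →
            ENNReal.ofReal (T ^ (-1 / 2 : ℝ)) *
              OULQR.normOmegaT μ T
                (fun t ω => OULQR.feedback B R P Z t ω
                  - OULQR.feedback B R (Pk (k + 1)) Zk t ω)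
              ≤ ENNReal.ofReal (c * ‖Pk (k + 1) - Pk k‖ ^ 2)) := by
  have hS := OULQR.isPositive_controlOp B hR
  have hQ : (ContinuousLinearMap.adjoint C ∘L C).IsPositive := C.isPositive_adjoint_comp_self
  obtain ⟨p, hp0, hpos, heq, hdec⟩ := OULQR.exists_kleinman_seq hA hS hQ
  obtain ⟨P, hP, hric, hlim, hmono, c, hc⟩ :=
    OULQR.kleinman_convergence hA hS hQ hpos heq hdec
  have hcl := hric.isExpStable hA hS hQ hP
  obtain ⟨δ, c', hδ, hc'0, hc'⟩ :=
    OULQR.exists_normOmegaT_feedback_sub_le (B := B) (K := K) (R := R) hW hξ hξ2 hcl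
  -- `p` starts with `0`, whose gain is `L₀`; the operators in question start one step later
  refine ⟨P, fun k => p (k + 1), fun Q => ⟨fun h => ?_, ?_⟩,
    OULQR.feedbackIsOptimal hW hξ hξ2 hA hric hR hP, fun k T => ?_, fun k => hpos _,
    fun k => ⟨hdec k, hmono k⟩, hlim.comp (tendsto_add_atTop_nat 1), ⟨c, hc⟩, fun k => ?_,
    δ, c' * c, hδ, fun k hk Z Y hZ hY T hT => ?_⟩
  · exact OULQR.RiccatiEq.unique hA hS hQ h.1.isPositive hP
      ((OULQR.isRiccatiSolution_iff Q).1 h.2) hric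
  · rintro rfl
    exact ⟨hric.isPosDefOp hAC hP, (OULQR.isRiccatiSolution_iff Q).2 hric⟩
  · rw [OULQR.iterGain_succ_shift B R hp0,
      OULQR.isLyapunovSolution_gain_iff hR (hpos k).isSelfAdjoint]
    exact heq k T
  · obtain ⟨Z, hZ⟩ := OULQR.exists_isOUProcess (B := B) (K := K) hW hξ
      (A - OULQR.controlOp B R * p (k + 1))
    exact ⟨Z, OULQR.isOUProcess_feedback_iff.2 hZ⟩
  · refine (hc' _ hk Z Y hZ hY T hT).trans (ENNReal.ofReal_le_ofReal ?_)
    rw [mul_assoc, norm_sub_rev]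
    exact mul_le_mul_of_nonneg_left (hc k).2 hc'0
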